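/- Let $K$ be a field, $R = K[x_0,\dots,x_n]$ the standard graded polynomial ring, and $\mathfrak m = (x_0,\dots,x_n)$. For a $\mathbb Z$-graded $R$-module $M$ let $H^i_{\mathfrak m}(M)$ denote the graded local cohomology modules of $M$, and let $M(e)$ be the shifted module with $[M(e)]_j = [M]_{j+e}$. A homogeneous ideal $I$ is called unmixed if $\dim R/P = \dim R/I$ for every associated prime $P$ of $R/I$. (Basic double link) Let $0 \neq J \subset I \subset R$ be homogeneous ideals such that $\operatorname{codim} I = \operatorname{codim} J + 1$ and $R/J$ is Cohen--Macaulay. Let $f \in R$ be a homogeneous element of degree $d$ such that $J : f = J$, i.e. such that $f$ is a nonzerodivisor modulo $J$. Then the ideal $\tilde I := J + fI$ satisfies $\operatorname{codim} \tilde I = \operatorname{codim} I$, and there are isomorphisms of graded $R$-modules (of degree zero) $$H^i_{\mathfrak m}(R/\tilde I) \cong H^i_{\mathfrak m}(R/I)(-d) \quad \text{for all } i < \dim R/I.$$ In particular, $I$ is unmixed if and only if $\tilde I$ is unmixed. -/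

import Mathlib

open CategoryTheory

universe u

noncomputable section

namespace BasicDoubleLink

/-! ### Commutative algebra in `R = K[x_0, ..., x_n]` -/

/-- The homogeneous maximal ideal `𝔪 = (x_0, ..., x_n)` of `K[x_0, ..., x_n]`. -/
def irrelevant (n : ℕ) (K : Type u) [Field K] : Ideal (MvPolynomial (Fin (n + 1)) K) :=
  Ideal.span (Set.range MvPolynomial.X)

attribute [local instance] MvPolynomial.gradedAlgebra in
/-- Homogeneous ideals of `K[x_0, ..., x_n]` for the standard grading. -/
abbrev IsHomogeneousIdeal {n : ℕ} {K : Type u} [Field K]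
    (I : Ideal (MvPolynomial (Fin (n + 1)) K)) : Prop :=
  I.IsHomogeneous (MvPolynomial.homogeneousSubmodule (Fin (n + 1)) K)

/-- The depth of `R/J`: the supremum of the lengths of the `R/J`-regular sequences of elements
of `𝔪`. -/
def depth {n : ℕ} {K : Type u} [Field K] (J : Ideal (MvPolynomial (Fin (n + 1)) K)) :
    WithBot ℕ∞ :=
  sSup {l | ∃ rs : List (MvPolynomial (Fin (n + 1)) K), (∀ r ∈ rs, r ∈ irrelevant n K) ∧
    RingTheory.Sequence.IsRegular (MvPolynomial (Fin (n + 1)) K ⧸ J) rs ∧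
    l = ((rs.length : ℕ∞) : WithBot ℕ∞)}

/-- `R/J` is Cohen-Macaulay: its depth equals its Krull dimension. -/
def IsCohenMacaulayQuotient {n : ℕ} {K : Type u} [Field K]
    (J : Ideal (MvPolynomial (Fin (n + 1)) K)) : Prop :=
  depth J = ringKrullDim (MvPolynomial (Fin (n + 1)) K ⧸ J)

/-- `I` is unmixed: all its components, embedded ones included, have the same dimension; that is,
`dim R/P = dim R/I` for every associated prime `P` of `R/I`. -/
def IsUnmixed {n : ℕ} {K : Type u} [Field K]
    (I : Ideal (MvPolynomial (Fin (n + 1)) K)) : Prop :=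
  ∀ P ∈ associatedPrimes (MvPolynomial (Fin (n + 1)) K) (MvPolynomial (Fin (n + 1)) K ⧸ I),
    ringKrullDim (MvPolynomial (Fin (n + 1)) K ⧸ P) =
      ringKrullDim (MvPolynomial (Fin (n + 1)) K ⧸ I)

/-! ### The category of graded modules -/

/-- The integers, made into a category in which a morphism `a ⟶ b` is a monomial of degree
`b - a` in `x_0, ..., x_n` (given by its exponent), and composition is multiplication. -/
@[ext]
structure Degrees (n : ℕ) where
  /-- the underlying integer -/
  deg : ℤ

instance (n : ℕ) : SmallCategory (Degrees n) where
  Hom a b := {s : Fin (n + 1) →₀ ℕ // a.deg + (s.degree : ℤ) = b.deg}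
  id a := ⟨0, by simp⟩
  comp s t := ⟨s.1 + t.1, by
    have hs := s.2
    have ht := t.2
    rw [map_add]
    push_cast
    omega⟩
  id_comp s := Subtype.ext (zero_add s.1)
  comp_id s := Subtype.ext (add_zero s.1)
  assoc s t r := Subtype.ext (add_assoc s.1 t.1 r.1)

/-- The category of `ℤ`-graded modules over `R = K[x_0, ..., x_n]` (not necessarily finitely
generated), with the homomorphisms of degree zero.

A graded module `M` consists of `K`-vector spaces `[M]_a`, `a ∈ ℤ`, and, for every monomial `x^s`
of degree `b - a`, a `K`-linear multiplication map `x^s : [M]_a → [M]_b`, such that `1` acts as the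
identity and `x^s (x^t m) = x^(s+t) m`; since the monomials of degree `e` are a `K`-basis of
`[R]_e`, this is the same as `K`-bilinear maps `[R]_e × [M]_a → [M]_(a+e)` which satisfy the module
axioms. A homomorphism is a family of `K`-linear maps `[M]_a → [N]_a` that commute with
multiplication by monomials. -/
abbrev GradedMod (n : ℕ) (K : Type u) [Field K] : Type (u + 1) :=
  Degrees n ⥤ ModuleCat.{u} K

/-- The category of graded modules has injective resolutions. -/
instance (n : ℕ) (K : Type u) [Field K] : HasInjectiveResolutions (GradedMod n K) := by
  have : Limits.HasCoproducts.{0} (ModuleCat.{u} K) := inferInstance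
  have : HasSeparator (GradedMod n K) :=
    HasSeparator.of_equivalence ((opOpEquivalence (Degrees n)).congrLeft (E := ModuleCat.{u} K))
  have : Limits.HasFilteredColimitsOfSize.{u, u} (GradedMod n K) := ⟨fun _ _ _ => inferInstance⟩
  have : AB5OfSize.{u, u} (GradedMod n K) := ⟨fun _ _ _ => inferInstance⟩
  have : IsGrothendieckAbelian.{u} (GradedMod n K) := {}
  infer_instance

/-- The functor `a ↦ a + e` on degrees. -/
@[simps]
def addDegree (n : ℕ) (e : ℤ) : Degrees n ⥤ Degrees n where
  obj a := ⟨a.deg + e⟩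
  map s := ⟨s.1, by have := s.2; dsimp only; omega⟩

/-- The shift `M(e)` of a graded module `M`: `[M(e)]_a = [M]_(a+e)`. -/
def shift {n : ℕ} {K : Type u} [Field K] (M : GradedMod n K) (e : ℤ) : GradedMod n K :=
  addDegree n e ⋙ M

/-! ### Local cohomology -/

section LocalCohomology

variable {n : ℕ} {K : Type u} [Field K]

/-- `[H⁰_𝔪(M)]_a`, the space of the `m ∈ [M]_a` with `𝔪 ^ k m = 0` for some `k`, that is,
such that every monomial of degree at least `k` annihilates `m`. -/
def torsion (M : GradedMod n K) (a : Degrees n) : Submodule K (M.obj a) where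
  carrier := {m | ∃ k : ℕ, ∀ (b : Degrees n) (s : a ⟶ b), k ≤ s.1.degree → M.map s m = 0}
  zero_mem' := ⟨0, fun b s _ => map_zero _⟩
  add_mem' := by
    rintro m m' ⟨k, hk⟩ ⟨k', hk'⟩
    refine ⟨max k k', fun b s hs => ?_⟩
    rw [map_add, hk b s (le_trans (le_max_left _ _) hs),
      hk' b s (le_trans (le_max_right _ _) hs), add_zero]
  smul_mem' := by
    rintro c m ⟨k, hk⟩
    exact ⟨k, fun b s hs => by rw [map_smul, hk b s hs, smul_zero]⟩

lemma torsion_map (M : GradedMod n K) {a b : Degrees n} (t : a ⟶ b) (m : M.obj a)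
    (hm : m ∈ torsion M a) : M.map t m ∈ torsion M b := by
  obtain ⟨k, hk⟩ := hm
  refine ⟨k, fun c s hs => ?_⟩
  have h := hk c (t ≫ s) (by
    change k ≤ (t.1 + s.1).degree
    rw [map_add]
    omega)
  rwa [M.map_comp, ModuleCat.comp_apply] at h

lemma torsion_app {M N : GradedMod n K} (φ : M ⟶ N) (a : Degrees n) (m : M.obj a)
    (hm : m ∈ torsion M a) : φ.app a m ∈ torsion N a := by
  obtain ⟨k, hk⟩ := hm
  refine ⟨k, fun c s hs => ?_⟩
  have h := ConcreteCategory.congr_hom (φ.naturality s) m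
  rw [ModuleCat.comp_apply, ModuleCat.comp_apply, hk c s hs, map_zero] at h
  exact h.symm

/-- The graded submodule `H⁰_𝔪(M)` of `M`. -/
def torsionObj (M : GradedMod n K) : GradedMod n K where
  obj a := ModuleCat.of K (torsion M a)
  map {a b} t := ModuleCat.ofHom ((M.map t).hom.restrict (torsion_map M t))
  map_id a := by
    ext m
    exact ConcreteCategory.congr_hom (M.map_id a) m.1
  map_comp t s := by
    ext m
    exact ConcreteCategory.congr_hom (M.map_comp t s) m.1

variable (n K) in
/-- The functor `H⁰_𝔪` from the category of graded modules to itself. -/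
def torsionFunctor : GradedMod n K ⥤ GradedMod n K where
  obj M := torsionObj M
  map {M N} φ :=
    { app := fun a => ModuleCat.ofHom ((φ.app a).hom.restrict (torsion_app φ a))
      naturality := fun a b t => by
        ext m
        exact Subtype.ext (ConcreteCategory.congr_hom (φ.naturality t) m.1) }
  map_id M := rfl
  map_comp φ ψ := rfl

instance : (torsionFunctor n K).Additive where
  map_add := rfl

/-- The graded local cohomology module `Hⁱ_𝔪(M)`: the `i`-th right derived functor of `H⁰_𝔪`
on the category of graded modules. -/
def localCohomologyModule (i : ℕ) (M : GradedMod n K) : GradedMod n K :=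
  ((torsionFunctor n K).rightDerived i).obj M

/-! ### The graded module `R/I` -/

/-- `[R/I]_a`: the image in `R/I` of the space of forms of degree `a` (zero for `a < 0`). -/
def quotientPart (I : Ideal (MvPolynomial (Fin (n + 1)) K)) (a : ℤ) :
    Submodule K (MvPolynomial (Fin (n + 1)) K ⧸ I) where
  carrier := {y | ∃ p : MvPolynomial (Fin (n + 1)) K,
    (∀ s ∈ p.support, (s.degree : ℤ) = a) ∧ Ideal.Quotient.mk I p = y}
  zero_mem' := ⟨0, by simp, map_zero _⟩
  add_mem' := by
    classical
    rintro _ _ ⟨p, hp, rfl⟩ ⟨q, hq, rfl⟩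
    refine ⟨p + q, fun s hs => ?_, map_add _ _ _⟩
    rcases Finset.mem_union.mp (MvPolynomial.support_add hs) with h | h
    · exact hp s h
    · exact hq s h
  smul_mem' := by
    rintro c _ ⟨p, hp, rfl⟩
    exact ⟨c • p, fun s hs => hp s (MvPolynomial.support_smul hs), rfl⟩

lemma quotientPart_mul (I : Ideal (MvPolynomial (Fin (n + 1)) K)) {a b : Degrees n} (t : a ⟶ b)
    (y : MvPolynomial (Fin (n + 1)) K ⧸ I) (hy : y ∈ quotientPart I a.deg) :
    LinearMap.mulLeft K (Ideal.Quotient.mk I (MvPolynomial.monomial t.1 1)) y ∈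
      quotientPart I b.deg := by
  classical
  obtain ⟨p, hp, rfl⟩ := hy
  refine ⟨MvPolynomial.monomial t.1 1 * p, fun s hs => ?_, map_mul _ _ _⟩
  obtain ⟨s₁, h₁, s₂, h₂, rfl⟩ := Finset.mem_add.mp (MvPolynomial.support_mul _ _ hs)
  have h₃ := Finset.mem_singleton.mp (MvPolynomial.support_monomial_subset h₁)
  have h₄ := hp s₂ h₂
  have h₅ := t.2
  rw [map_add, h₃]
  push_cast
  omega

/-- `R/I` as a graded module, for a homogeneous ideal `I`: its components are the `[R/I]_a`, and
monomials act by multiplication. -/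
def quotientModule (I : Ideal (MvPolynomial (Fin (n + 1)) K)) : GradedMod n K where
  obj a := ModuleCat.of K (quotientPart I a.deg)
  map {a b} t := ModuleCat.ofHom
    ((LinearMap.mulLeft K (Ideal.Quotient.mk I (MvPolynomial.monomial t.1 1))).restrict
      (quotientPart_mul I t))
  map_id a := by
    ext m
    change Ideal.Quotient.mk I 1 * m.1 = m.1
    rw [map_one, one_mul]
  map_comp {a b c} t s := by
    ext m
    change Ideal.Quotient.mk I (MvPolynomial.monomial (t.1 + s.1) 1) * m.1 =
      Ideal.Quotient.mk I (MvPolynomial.monomial s.1 1) *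
        (Ideal.Quotient.mk I (MvPolynomial.monomial t.1 1) * m.1)
    rw [← mul_assoc, ← map_mul, MvPolynomial.monomial_mul, one_mul, add_comm t.1]

end LocalCohomology

end BasicDoubleLink

end

/-! Write `Ĩ = J + fI` and let `A = I/J` be the kernel of `R/J → R/I`. Since `f` is a nonzerodivisor
modulo `J`, multiplication by `f` embeds `A` in `(R/J)(d)` with cokernel `(R/Ĩ)(d)`. Thus `A` is the
left term of two short exact sequences whose middle terms are `R/J` and a shift of it. As `R/J` is
Cohen-Macaulay of dimension `dim R/I + 1`, the local cohomology of both middle terms vanishes in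
degrees `i` and `i + 1` for `i < dim R/I`, and the connecting maps give `Hⁱ(R/I) ≅ Hⁱ⁺¹(A) ≅
Hⁱ(R/Ĩ)(d)`; see `nonempty_localCohomologyModule_iso`.

Depth is defined by regular sequences that need not be homogeneous, whereas local cohomology lives
in the graded category. The bridge is `ExtVanishing`: the vanishing of `Extⁱ(R/𝔪, R/J)` below the
depth follows from any regular sequence, drops by one modulo any nonzerodivisor, and produces a
homogeneous nonzerodivisor `x` through homogeneous prime avoidance. By induction multiplication by
each `xᵏ` is then injective on `Hⁱ(R/J)`; since every class is killed by forms of large degree,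
`Hⁱ(R/J) = 0`.

For unmixedness, `Ass(R/I) ⊆ Ass(R/Ĩ) ⊆ Ass(R/I) ∪ Ass(R/(J + (f)))`. The primes from the last set
have dimension at least `dim R/J - 1`, because depth bounds the dimension of associated primes
(`ExtVanishing.le_ringKrullDim`). The formula `height + dim = n + 1` for proper homogeneous ideals
translates codimensions into dimensions. -/

noncomputable section

namespace BasicDoubleLink

/-! ### Vanishing of `Ext` below the depth -/

section ExtVanishing

open Abelian

variable {R : Type u} [CommRing R]

/-- `Extⁱ(R/𝔞, M) = 0` for all `i < s`. -/
def ExtVanishing (𝔞 : Ideal R) (M : Type u) [AddCommGroup M] [Module R M] (s : ℕ) : Prop :=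
  ∀ i < s, Subsingleton (Ext (ModuleCat.of R (R ⧸ 𝔞)) (ModuleCat.of R M) i)

variable {𝔞 : Ideal R} {M N : Type u} [AddCommGroup M] [Module R M] [AddCommGroup N] [Module R N]

/-- The scalar `r` may act through the first argument of `Ext`, where it is zero on `R/𝔞`. -/
lemma smul_ext_eq_zero {r : R} (hr : r ∈ 𝔞) (X : ModuleCat.{u} R) {i : ℕ}
    (x : Ext (ModuleCat.of R (R ⧸ 𝔞)) X i) : r • x = 0 := by
  have h : r • 𝟙 (ModuleCat.of R (R ⧸ 𝔞)) = 0 := by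
    refine ModuleCat.hom_ext (LinearMap.ext fun y => ?_)
    obtain ⟨y, rfl⟩ := Ideal.Quotient.mk_surjective y
    change r • Ideal.Quotient.mk 𝔞 y = 0
    rw [← Ideal.Quotient.mk_eq_mk, ← Submodule.Quotient.mk_smul, Submodule.Quotient.mk_eq_zero]
    exact 𝔞.mul_mem_right _ hr
  calc r • x = r • ((Ext.mk₀ (𝟙 _)).comp x (zero_add i)) := by rw [Ext.mk₀_id_comp]
    _ = (Ext.mk₀ (r • 𝟙 (ModuleCat.of R (R ⧸ 𝔞)))).comp x (zero_add i) := by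
      rw [Ext.mk₀_smul, Ext.smul_comp]
    _ = 0 := by rw [h, Ext.mk₀_zero, Ext.zero_comp]

/-- The short complex `M → M → N` whose first map is multiplication by `r`. -/
abbrev smulComplex (r : R) (g : M →ₗ[R] N) (hg : Function.Exact (LinearMap.lsmul R M r) g) :
    ShortComplex (ModuleCat.{u} R) :=
  ShortComplex.mk (ModuleCat.ofHom (LinearMap.lsmul R M r)) (ModuleCat.ofHom g) (by
    ext m
    exact (hg _).2 ⟨m, rfl⟩)

lemma smulComplex_shortExact {r : R} {g : M →ₗ[R] N}
    (hr : IsSMulRegular M r) (hg : Function.Exact (LinearMap.lsmul R M r) g)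
    (hs : Function.Surjective g) : (smulComplex r g hg).ShortExact where
  exact := by
    rw [ShortComplex.moduleCat_exact_iff]
    exact fun x hx => (hg x).1 hx
  mono_f := by
    rw [ModuleCat.mono_iff_injective]
    exact hr
  epi_g := by
    rw [ModuleCat.epi_iff_surjective]
    exact hs

/-- In the long exact sequence, `Extⁱ(R/𝔞, N)` lies between `Extⁱ(R/𝔞, M)` and `Extⁱ⁺¹(R/𝔞, M)`;
this costs one degree. -/
lemma ExtVanishing.of_exact {r : R} {g : M →ₗ[R] N}
    (hr : IsSMulRegular M r) (hg : Function.Exact (LinearMap.lsmul R M r) g)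
    (hs : Function.Surjective g) {s : ℕ} (h : ExtVanishing 𝔞 M (s + 1)) :
    ExtVanishing 𝔞 N s := fun i hi => by
  have hS := smulComplex_shortExact hr hg hs
  have h₁ := h i (by omega)
  have h₂ := h (i + 1) (by omega)
  refine subsingleton_of_forall_eq 0 fun x => ?_
  obtain ⟨y, rfl⟩ := Ext.covariant_sequence_exact₃ _ hS x rfl (h₂.elim _ _)
  rw [h₁.elim y 0, Ext.zero_comp]

/-- Multiplication by `r` on `Extⁱ(R/𝔞, M)` is zero, but its kernel is the image of `Extⁱ⁻¹(R/𝔞, N)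
= 0`, so the whole group vanishes. For `i = 0` injectivity comes from left exactness of `Hom`. -/
lemma ExtVanishing.succ {r : R} (hra : r ∈ 𝔞) {g : M →ₗ[R] N}
    (hr : IsSMulRegular M r) (hg : Function.Exact (LinearMap.lsmul R M r) g)
    (hs : Function.Surjective g) {s : ℕ} (h : ExtVanishing 𝔞 N s) :
    ExtVanishing 𝔞 M (s + 1) := fun i hi => by
  have hS := smulComplex_shortExact hr hg hs
  refine subsingleton_of_forall_eq 0 fun x => ?_
  have hx : x.comp (Ext.mk₀ (smulComplex r g hg).f) (add_zero i) = 0 := by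
    have : (smulComplex r g hg).f = r • 𝟙 (ModuleCat.of R M) := rfl
    rw [this, ← Ext.smul_eq_comp_mk₀]
    exact smul_ext_eq_zero hra _ x
  obtain _ | i := i
  · have hm := hS.mono_f
    exact Ext.postcomp_mk₀_injective_of_mono _ (smulComplex r g hg).f
      (hx.trans (Ext.zero_comp (Z := ModuleCat.of R M) _ _ _ _ (add_zero 0)).symm)
  · obtain ⟨y, rfl⟩ := Ext.covariant_sequence_exact₁ _ hS x hx (n₀ := i) rfl
    have h₁ := h i (by omega)
    rw [h₁.elim y 0, Ext.zero_comp]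

lemma ExtVanishing.of_isWeaklyRegular {rs : List R} (hrs : ∀ r ∈ rs, r ∈ 𝔞)
    (h : RingTheory.Sequence.IsWeaklyRegular M rs) : ExtVanishing 𝔞 M rs.length := by
  induction rs generalizing M with
  | nil => exact fun i hi => absurd hi (Nat.not_lt_zero i)
  | cons r rs ih =>
    rw [RingTheory.Sequence.isWeaklyRegular_cons_iff] at h
    exact ExtVanishing.succ (hrs r (List.mem_cons_self)) h.1
      (LinearMap.exact_lsmul_mkQ_smul_top M r) (Submodule.mkQ_surjective _)
      (ih (fun r' hr' => hrs r' (List.mem_cons_of_mem _ hr')) h.2)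

/-- `J : r = J`. -/
def IsRegularMod (J : Ideal R) (r : R) : Prop := ∀ p, r * p ∈ J → p ∈ J

lemma IsRegularMod.isSMulRegular {J : Ideal R} {r : R} (h : IsRegularMod J r) :
    IsSMulRegular (R ⧸ J) r := by
  rw [isSMulRegular_iff_right_eq_zero_of_smul]
  intro y hy
  obtain ⟨y, rfl⟩ := Ideal.Quotient.mk_surjective y
  rw [← Ideal.Quotient.mk_eq_mk, ← Submodule.Quotient.mk_smul, Submodule.Quotient.mk_eq_zero] at hy
  exact Ideal.Quotient.eq_zero_iff_mem.2 (h y hy)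

lemma IsRegularMod.pow {J : Ideal R} {r : R} (h : IsRegularMod J r) (k : ℕ) :
    IsRegularMod J (r ^ k) := by
  induction k with
  | zero => exact fun p hp => by simpa using hp
  | succ k ih => exact fun p hp => ih p (h _ (by rwa [← mul_assoc, ← pow_succ']))

lemma exact_lsmul_factor (J : Ideal R) (r : R) :
    Function.Exact (LinearMap.lsmul R (R ⧸ J) r)
      (Submodule.factor (le_sup_left : J ≤ J ⊔ Ideal.span {r})) := by
  intro y
  obtain ⟨y, rfl⟩ := Ideal.Quotient.mk_surjective y
  change Ideal.Quotient.mk (J ⊔ Ideal.span {r}) y = 0 ↔ _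
  rw [Ideal.Quotient.eq_zero_iff_mem, Submodule.mem_sup]
  constructor
  · rintro ⟨a, ha, b, hb, rfl⟩
    obtain ⟨c, rfl⟩ := Ideal.mem_span_singleton'.1 hb
    refine ⟨Ideal.Quotient.mk J c, ?_⟩
    change Ideal.Quotient.mk J (r * c) = _
    rw [map_add, Ideal.Quotient.eq_zero_iff_mem.2 ha, zero_add, mul_comm]
  · rintro ⟨z, hz⟩
    obtain ⟨z, rfl⟩ := Ideal.Quotient.mk_surjective z
    change Ideal.Quotient.mk J (r * z) = _ at hz
    refine ⟨y - r * z, ?_, r * z, Ideal.mul_mem_right _ _ (Ideal.mem_span_singleton_self r), by ring⟩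
    exact (Ideal.Quotient.eq.1 hz.symm)

lemma ExtVanishing.sup_span {J : Ideal R} {r : R} (hr : IsRegularMod J r) {s : ℕ}
    (h : ExtVanishing 𝔞 (R ⧸ J) (s + 1)) : ExtVanishing 𝔞 (R ⧸ (J ⊔ Ideal.span {r})) s :=
  h.of_exact hr.isSMulRegular (exact_lsmul_factor J r) (Submodule.factor_surjective _)

lemma ExtVanishing.of_sup_span {J : Ideal R} {r : R} (hra : r ∈ 𝔞) (hr : IsRegularMod J r) {s : ℕ}
    (h : ExtVanishing 𝔞 (R ⧸ (J ⊔ Ideal.span {r})) s) : ExtVanishing 𝔞 (R ⧸ J) (s + 1) :=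
  h.succ hra hr.isSMulRegular (exact_lsmul_factor J r) (Submodule.factor_surjective _)

/-- An element `p` with `𝔞 p ⊆ J` defines a homomorphism `R/𝔞 → R/J`, `1 ↦ p`, which is zero because
`Ext⁰ = 0`. -/
lemma ExtVanishing.notMem_of_mul_mem {J : Ideal R} {s : ℕ} (h : ExtVanishing 𝔞 (R ⧸ J) (s + 1))
    {p : R} (hp : ∀ a ∈ 𝔞, a * p ∈ J) : p ∈ J := by
  have h₀ := h 0 (by omega)
  let φ : (R ⧸ 𝔞) →ₗ[R] (R ⧸ J) := Submodule.liftQ 𝔞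
    (LinearMap.toSpanSingleton R (R ⧸ J) (Ideal.Quotient.mk J p)) fun a ha => by
      change Ideal.Quotient.mk J (a * p) = 0
      exact Ideal.Quotient.eq_zero_iff_mem.2 (hp a ha)
  have h₁ : Ext.mk₀ (ModuleCat.ofHom φ) = 0 := h₀.elim _ _
  rw [Ext.mk₀_eq_zero_iff] at h₁
  have h₂ : φ (Ideal.Quotient.mk 𝔞 1) = 0 := ConcreteCategory.congr_hom h₁ (Ideal.Quotient.mk 𝔞 1)
  have h₃ : φ (Ideal.Quotient.mk 𝔞 1) = Ideal.Quotient.mk J (1 * p) := rfl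
  rw [h₃, one_mul] at h₂
  exact Ideal.Quotient.eq_zero_iff_mem.1 h₂

end ExtVanishing

variable {n : ℕ} {K : Type u} [Field K]

lemma extVanishing_of_isCohenMacaulayQuotient {J : Ideal (MvPolynomial (Fin (n + 1)) K)}
    (hJ : IsCohenMacaulayQuotient J) {r : ℕ}
    (hr : ringKrullDim (MvPolynomial (Fin (n + 1)) K ⧸ J) = r) :
    ExtVanishing (irrelevant n K) (MvPolynomial (Fin (n + 1)) K ⧸ J) r := by
  obtain _ | r := r
  · exact fun i hi => absurd hi (Nat.not_lt_zero i)
  have h : depth J = ((r + 1 : ℕ) : WithBot ℕ∞) := hJ.trans hr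
  -- The supremum is not known to be attained, so a sequence longer than `r` is extracted from `r <
  -- depth J`.
  have h₁ : ((r : ℕ∞) : WithBot ℕ∞) < depth J := by
    rw [h]
    exact_mod_cast Nat.lt_succ_self r
  obtain ⟨l, ⟨rs, hrs, hreg, rfl⟩, hl⟩ := lt_sSup_iff.1 h₁
  have h₂ : r < rs.length := by exact_mod_cast hl
  exact fun i hi => ExtVanishing.of_isWeaklyRegular hrs hreg.toIsWeaklyRegular i (by omega)

end BasicDoubleLink
end

noncomputable section

namespace BasicDoubleLink

open MvPolynomial

variable {n : ℕ} {K : Type u} [Field K]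

local notation "𝓡" => MvPolynomial (Fin (n + 1)) K

/-! ### Homogeneous ideals and homogeneous components -/

lemma isHomogeneousIdeal_iff {I : Ideal 𝓡} :
    IsHomogeneousIdeal I ↔ ∀ p ∈ I, ∀ j, homogeneousComponent j p ∈ I :=
  ⟨fun h _ hp j => homogeneousComponent_mem_of_mem h hp j, fun h j p hp => by
    have := h p hp j
    rwa [← decomposition.decompose'_apply] at this⟩

lemma IsHomogeneousIdeal.exists_isHomogeneous_notMem {I : Ideal 𝓡} (hI : IsHomogeneousIdeal I)
    {P : Ideal 𝓡} (h : ¬ I ≤ P) : ∃ j, ∃ q ∈ I, q.IsHomogeneous j ∧ q ∉ P := by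
  obtain ⟨q, hq, hqP⟩ := SetLike.not_le_iff_exists.1 h
  by_contra! hc
  refine hqP ?_
  rw [← sum_homogeneousComponent q]
  exact P.sum_mem fun j _ => hc j _ (isHomogeneousIdeal_iff.1 hI q hq j)
    (homogeneousComponent_isHomogeneous j q)

lemma homogeneousComponent_mul_of_isHomogeneous {f : 𝓡} {d : ℕ} (hf : f.IsHomogeneous d) (p : 𝓡)
    (j : ℕ) : homogeneousComponent (d + j) (f * p) = f * homogeneousComponent j p := by
  conv_lhs => rw [← sum_homogeneousComponent p, Finset.mul_sum, map_sum]
  have h : ∀ i, homogeneousComponent (d + j) (f * homogeneousComponent i p) =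
      if i = j then f * homogeneousComponent j p else 0 := fun i => by
    rw [homogeneousComponent_of_mem (hf.mul (homogeneousComponent_isHomogeneous i p))]
    by_cases hij : i = j
    · simp [hij]
    · rw [if_neg hij, if_neg (by omega)]
  simp_rw [h]
  rw [Finset.sum_ite_eq']
  split_ifs with hj
  · rfl
  · rw [homogeneousComponent_eq_zero _ _ (by simpa using hj), mul_zero]

lemma homogeneousComponent_mul_of_lt {f : 𝓡} {d : ℕ} (hf : f.IsHomogeneous d) (p : 𝓡)
    {j : ℕ} (hj : j < d) : homogeneousComponent j (f * p) = 0 := by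
  conv_lhs => rw [← sum_homogeneousComponent p, Finset.mul_sum, map_sum]
  refine Finset.sum_eq_zero fun i _ => ?_
  rw [homogeneousComponent_of_mem (hf.mul (homogeneousComponent_isHomogeneous i p)),
    if_neg (by omega)]

attribute [local instance] MvPolynomial.gradedAlgebra in
lemma isHomogeneousIdeal_span_singleton {f : 𝓡} {d : ℕ} (hf : f.IsHomogeneous d) :
    IsHomogeneousIdeal (Ideal.span {f}) :=
  Ideal.homogeneous_span _ _ fun x hx => ⟨d, by rw [Set.mem_singleton_iff.1 hx]; exact hf⟩

attribute [local instance] MvPolynomial.gradedAlgebra in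
lemma IsHomogeneousIdeal.sup {I J : Ideal 𝓡} (hI : IsHomogeneousIdeal I)
    (hJ : IsHomogeneousIdeal J) : IsHomogeneousIdeal (I ⊔ J) :=
  Ideal.IsHomogeneous.sup hI hJ

attribute [local instance] MvPolynomial.gradedAlgebra in
lemma isHomogeneousIdeal_irrelevant : IsHomogeneousIdeal (irrelevant n K) :=
  Ideal.homogeneous_span _ _ fun x hx => by
    obtain ⟨i, rfl⟩ := hx
    exact ⟨1, isHomogeneous_X K i⟩

lemma constantCoeff_eq_zero_of_mem_irrelevant {p : 𝓡} (hp : p ∈ irrelevant n K) :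
    coeff 0 p = 0 := by
  have h : irrelevant n K ≤ RingHom.ker (constantCoeff (σ := Fin (n + 1)) (R := K)) := by
    rw [irrelevant, Ideal.span_le]
    rintro _ ⟨i, rfl⟩
    simp
  exact h hp

lemma mem_irrelevant_of_isHomogeneous {p : 𝓡} {e : ℕ} (hp : p.IsHomogeneous e) (he : 0 < e) :
    p ∈ irrelevant n K := by
  rw [irrelevant, ← Set.image_univ, mem_ideal_span_X_image]
  intro m hm
  by_contra! hc
  have : m = 0 := Finsupp.ext fun i => hc i (Set.mem_univ i)
  have h := hp.degree_eq_sum_deg_support hm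
  simp [this] at h
  omega

lemma pos_of_isHomogeneous_of_mem_irrelevant {p : 𝓡} {e : ℕ} (hp : p.IsHomogeneous e)
    (hp0 : p ≠ 0) (hm : p ∈ irrelevant n K) : 0 < e := by
  rcases Nat.eq_zero_or_pos e with rfl | he
  · refine absurd ?_ hp0
    rw [← homogeneousComponent_eq_self hp, homogeneousComponent_zero,
      constantCoeff_eq_zero_of_mem_irrelevant hm, C_0]
  · exact he

/-! ### Homogeneous prime avoidance -/

/-- Classical prime avoidance by induction on the number of primes. The sum of an element avoiding
all primes but `P` and one lying in all primes but `P` is made homogeneous by raising both to powers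
of equal degree; this needs positive degrees, whence `𝔞 ≤ 𝔪`. -/
lemma exists_isHomogeneous_notMem_of_finset {𝔞 : Ideal 𝓡} (h𝔞 : IsHomogeneousIdeal 𝔞)
    (hm : 𝔞 ≤ irrelevant n K) (S : Finset (Ideal 𝓡))
    (hS : ∀ P ∈ S, P.IsPrime ∧ IsHomogeneousIdeal P ∧ ¬ 𝔞 ≤ P) :
    ∃ e > 0, ∃ x ∈ 𝔞, x.IsHomogeneous e ∧ ∀ P ∈ S, x ∉ P := by
  classical
  induction hc : S.card using Nat.strong_induction_on generalizing S with
  | _ c ih =>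
  -- A prime contained in another one may be dropped; otherwise the primes are pairwise
  -- incomparable.
  by_cases hanti : ∃ P ∈ S, ∃ Q ∈ S, P ≠ Q ∧ Q ≤ P
  · obtain ⟨P, hP, Q, hQ, hne, hle⟩ := hanti
    obtain ⟨e, he, x, hx, hxe, hxS⟩ := ih (S.erase Q).card
      (hc ▸ Finset.card_erase_lt_of_mem hQ) (S.erase Q)
      (fun P' hP' => hS P' (Finset.mem_of_mem_erase hP')) rfl
    refine ⟨e, he, x, hx, hxe, fun P' hP' => ?_⟩
    by_cases h : P' = Q
    · exact fun hxP => hxS P (Finset.mem_erase.2 ⟨hne, hP⟩) (hle (h ▸ hxP))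
    · exact hxS P' (Finset.mem_erase.2 ⟨h, hP'⟩)
  · push Not at hanti
    obtain rfl | ⟨P, hP⟩ := S.eq_empty_or_nonempty
    · exact ⟨1, one_pos, 0, 𝔞.zero_mem, isHomogeneous_zero _ _ _, by simp⟩
    obtain ⟨hPp, hPh, hPa⟩ := hS P hP
    obtain ⟨e, he, x, hx, hxe, hxS⟩ := ih (S.erase P).card
      (hc ▸ Finset.card_erase_lt_of_mem hP) (S.erase P)
      (fun P' hP' => hS P' (Finset.mem_of_mem_erase hP')) rfl
    by_cases hxP : x ∈ P
    swap
    · refine ⟨e, he, x, hx, hxe, fun P' hP' => ?_⟩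
      by_cases h : P' = P
      · exact h ▸ hxP
      · exact hxS P' (Finset.mem_erase.2 ⟨h, hP'⟩)
    obtain ⟨a, y₀, hy₀, hy₀h, hy₀P⟩ := h𝔞.exists_isHomogeneous_notMem hPa
    -- The value `1` outside `S.erase P` is only a filler that makes the choice total in `Q`.
    have hq : ∀ Q, ∃ j, ∃ q : 𝓡, q.IsHomogeneous j ∧ q ∉ P ∧ (Q ∈ S.erase P → q ∈ Q) := by
      intro Q
      by_cases hQ : Q ∈ S.erase P
      · obtain ⟨hne, hQS⟩ := Finset.mem_erase.1 hQ
        obtain ⟨j, q, hq, hqh, hqP⟩ :=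
          (hS Q hQS).2.1.exists_isHomogeneous_notMem (hanti P hP Q hQS hne.symm)
        exact ⟨j, q, hqh, hqP, fun _ => hq⟩
      · exact ⟨0, 1, isHomogeneous_one _ _, fun h => hPp.ne_top ((Ideal.eq_top_iff_one _).2 h),
          fun h => absurd h hQ⟩
    choose j q hqh hqP hqQ using hq
    have hy : ∃ e' > 0, ∃ y ∈ 𝔞, y.IsHomogeneous e' ∧ y ∉ P ∧ ∀ Q ∈ S.erase P, y ∈ Q := by
      have hyP : y₀ * ∏ Q ∈ S.erase P, q Q ∉ P := fun h => by
        rcases hPp.mem_or_mem h with h | h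
        · exact hy₀P h
        · obtain ⟨Q, -, hQ⟩ := (hPp.prod_mem_iff).1 h
          exact hqP Q hQ
      have hya : y₀ * ∏ Q ∈ S.erase P, q Q ∈ 𝔞 := 𝔞.mul_mem_right _ hy₀
      have hyh := hy₀h.mul (IsHomogeneous.prod (S.erase P) q j fun Q _ => hqh Q)
      refine ⟨_, pos_of_isHomogeneous_of_mem_irrelevant hyh ?_ (hm hya), _, hya, hyh, hyP,
        fun Q hQ => Q.mul_mem_left _ (Ideal.mem_of_dvd _ (Finset.dvd_prod_of_mem q hQ) (hqQ Q hQ))⟩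
      rintro h
      rw [h] at hyP
      exact hyP P.zero_mem
    obtain ⟨e', he', y, hya, hyh, hyP, hyQ⟩ := hy
    -- Both `x ^ e'` and `y ^ e` have degree `e * e'`. Modulo `P` only the second survives, modulo
    -- the other primes only the first.
    refine ⟨e * e', Nat.mul_pos he he', x ^ e' + y ^ e, 𝔞.add_mem (𝔞.pow_mem_of_mem hx _ he')
      (𝔞.pow_mem_of_mem hya _ he), (hxe.pow e').add (by simpa [mul_comm] using hyh.pow e),
      fun Q hQ => ?_⟩
    by_cases h : Q = P
    · subst h
      rw [Q.add_mem_iff_right (Q.pow_mem_of_mem hxP _ he')]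
      exact fun hh => hyP (hPp.mem_of_pow_mem _ hh)
    · have hQ' := Finset.mem_erase.2 ⟨h, hQ⟩
      rw [Q.add_mem_iff_left (Q.pow_mem_of_mem (hyQ Q hQ') _ he)]
      exact fun hh => hxS Q hQ' ((hS Q hQ).1.mem_of_pow_mem _ hh)

/-! ### Homogeneous regular elements -/

lemma mem_associatedPrimes_quotient_iff {A : Type u} [CommRing A] [IsNoetherianRing A]
    {J P : Ideal A} :
    P ∈ associatedPrimes A (A ⧸ J) ↔ P.IsPrime ∧ ∃ p, ∀ a, a ∈ P ↔ a * p ∈ J := by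
  rw [AssociatedPrimes.mem_iff, isAssociatedPrime_iff]
  refine and_congr_right fun _ => ⟨?_, ?_⟩
  · rintro ⟨y, rfl⟩
    obtain ⟨y, rfl⟩ := Ideal.Quotient.mk_surjective y
    refine ⟨y, fun a => ?_⟩
    rw [Submodule.mem_colon_singleton, Submodule.mem_bot]
    exact Ideal.Quotient.eq_zero_iff_mem (I := J) (a := a * y)
  · rintro ⟨y, hy⟩
    refine ⟨Ideal.Quotient.mk J y, Ideal.ext fun a => ?_⟩
    rw [hy, Submodule.mem_colon_singleton, Submodule.mem_bot]
    exact (Ideal.Quotient.eq_zero_iff_mem (I := J) (a := a * y)).symm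

lemma mul_homogeneousComponent_mem {J : Ideal 𝓡} (hJ : IsHomogeneousIdeal J) {x : 𝓡} {e : ℕ}
    (hx : x.IsHomogeneous e) {q : 𝓡} (h : x * q ∈ J) (j : ℕ) :
    x * homogeneousComponent j q ∈ J := by
  rw [← homogeneousComponent_mul_of_isHomogeneous hx]
  exact isHomogeneousIdeal_iff.1 hJ _ h _

attribute [local instance] MvPolynomial.gradedAlgebra in
/-- Annihilators modulo a homogeneous ideal of homogeneous elements are contained in homogeneous
associated primes. -/
lemma exists_homogeneous_associatedPrime {J : Ideal 𝓡} (hJ : IsHomogeneousIdeal J) {q : 𝓡} {j : ℕ}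
    (hq : q.IsHomogeneous j) (hqJ : q ∉ J) :
    ∃ P ∈ associatedPrimes 𝓡 (𝓡 ⧸ J), IsHomogeneousIdeal P ∧ ∀ a, a * q ∈ J → a ∈ P := by
  -- `P` is maximal among the annihilators modulo `J` of homogeneous elements outside `J` that
  -- contain `J : q`.
  obtain ⟨P, ⟨hle, j', h, hh, hhJ, hP⟩, hmax⟩ := set_has_maximal_iff_noetherian.2
    (inferInstance : IsNoetherianRing 𝓡)
    {P : Ideal 𝓡 | (∀ a, a * q ∈ J → a ∈ P) ∧ ∃ j' : ℕ, ∃ h : 𝓡, h.IsHomogeneous j' ∧ h ∉ J ∧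
      ∀ a, a ∈ P ↔ a * h ∈ J}
    ⟨(J.colon {q} : Ideal 𝓡), fun a ha => Submodule.mem_colon_singleton.2 ha, j, q, hq, hqJ,
      fun a => Submodule.mem_colon_singleton⟩
  have hPh : IsHomogeneousIdeal P := isHomogeneousIdeal_iff.2 fun a ha i => by
    rw [hP, mul_comm] at ha ⊢
    exact mul_homogeneousComponent_mem hJ hh ha i
  refine ⟨P, mem_associatedPrimes_quotient_iff.2 ⟨?_, h, hP⟩, hPh, hle⟩
  refine Ideal.IsHomogeneous.isPrime_of_homogeneous_mem_or_mem hPh ?_ ?_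
  · rw [Ne, Ideal.eq_top_iff_one, hP, one_mul]
    exact hhJ
  · rintro a b - ⟨k, hb⟩ hab
    by_contra! hc
    -- If `ab ∈ P` with `a, b ∉ P`, then `bh` has an annihilator strictly larger than `P = J : h`,
    -- against maximality.
    have hlt : P < (J.colon {b * h} : Ideal 𝓡) := by
      refine lt_of_le_of_ne (fun c hc => Submodule.mem_colon_singleton.2 ?_) fun heq => hc.1 ?_
      · change c * (b * h) ∈ J
        rw [mul_left_comm]
        exact J.mul_mem_left _ ((hP c).1 hc)
      · rw [heq]
        refine Submodule.mem_colon_singleton.2 ?_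
        change a * (b * h) ∈ J
        rw [← mul_assoc]
        exact (hP _).1 hab
    refine hmax _ ⟨fun c hc => hlt.le (hle c hc), k + j', b * h, IsHomogeneous.mul hb hh,
      fun hbh => hc.2 ((hP b).2 hbh), fun c => Submodule.mem_colon_singleton⟩ hlt

/-- For homogeneous `x`, regularity modulo `J` can be tested on homogeneous elements, so it suffices
that `x` avoids the finitely many homogeneous associated primes. -/
lemma exists_isHomogeneous_isRegularMod {J 𝔞 : Ideal 𝓡} (hJ : IsHomogeneousIdeal J)
    (h𝔞 : IsHomogeneousIdeal 𝔞) (hm : 𝔞 ≤ irrelevant n K)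
    (h : ∀ P ∈ associatedPrimes 𝓡 (𝓡 ⧸ J), ¬ 𝔞 ≤ P) :
    ∃ e > 0, ∃ x ∈ 𝔞, x.IsHomogeneous e ∧ IsRegularMod J x := by
  classical
  have hfin : {P ∈ associatedPrimes 𝓡 (𝓡 ⧸ J) | IsHomogeneousIdeal P}.Finite :=
    (associatedPrimes.finite 𝓡 (𝓡 ⧸ J)).subset (Set.sep_subset _ _)
  obtain ⟨e, he, x, hx, hxe, hxP⟩ := exists_isHomogeneous_notMem_of_finset h𝔞 hm hfin.toFinset
    (fun P hP => by
      rw [Set.Finite.mem_toFinset] at hP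
      exact ⟨hP.1.isPrime, hP.2, h P hP.1⟩)
  refine ⟨e, he, x, hx, hxe, fun q hq => ?_⟩
  rw [mem_iff_homogeneousComponent_mem hJ]
  by_contra! hc
  obtain ⟨j, hj⟩ := hc
  obtain ⟨P, hP, hPh, hle⟩ := exists_homogeneous_associatedPrime hJ
    (homogeneousComponent_isHomogeneous j q) hj
  exact hxP P (hfin.mem_toFinset.2 ⟨hP, hPh⟩) (hle x (mul_homogeneousComponent_mem hJ hxe hq j))

/-- No associated prime `J : p` contains `𝔪`, since `𝔪 p ⊆ J` would force `p ∈ J`. -/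
lemma ExtVanishing.exists_isRegularMod {J : Ideal 𝓡} (hJ : IsHomogeneousIdeal J) {s : ℕ}
    (h : ExtVanishing (irrelevant n K) (𝓡 ⧸ J) (s + 1)) :
    ∃ e > 0, ∃ x : 𝓡, x.IsHomogeneous e ∧ IsRegularMod J x := by
  obtain ⟨e, he, x, -, hx⟩ := exists_isHomogeneous_isRegularMod hJ isHomogeneousIdeal_irrelevant
    le_rfl fun P hP hle => by
      obtain ⟨hPp, p, hp⟩ := mem_associatedPrimes_quotient_iff.1 hP
      have : p ∈ J := h.notMem_of_mul_mem fun a ha => (hp a).1 (hle ha)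
      exact hPp.ne_top ((Ideal.eq_top_iff_one _).2 ((hp 1).2 (by rwa [one_mul])))
  exact ⟨e, he, x, hx⟩

/-- If `J` is homogeneous and `x` is homogeneous of positive degree, then `r ≡ 1 mod x` is a
nonzerodivisor modulo `J`. -/
lemma isRegularMod_of_sub_one_mem {J : Ideal 𝓡} (hJ : IsHomogeneousIdeal J) {x : 𝓡} {e : ℕ}
    (he : 0 < e) (hx : x.IsHomogeneous e) {r : 𝓡} (hr : r - 1 ∈ Ideal.span {x}) :
    IsRegularMod J r := by
  intro p hp
  obtain ⟨c, hc⟩ := Ideal.mem_span_singleton'.1 hr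
  rw [mem_iff_homogeneousComponent_mem hJ]
  intro j
  induction j using Nat.strong_induction_on generalizing p with
  | _ j ih =>
  -- Induction on the degree `j`: the component of `p` is that of `rp ∈ J` minus `x` times a lower
  -- component of `cp`, and `cp` satisfies the same hypothesis as `p`.
  have hrp : r * p = p + x * (c * p) := by
    rw [eq_add_of_sub_eq hc.symm]
    ring
  rcases lt_or_ge j e with hj | hj
  · have h := isHomogeneousIdeal_iff.1 hJ _ hp j
    rwa [hrp, map_add, homogeneousComponent_mul_of_lt hx _ hj, add_zero] at h
  · obtain ⟨i, rfl⟩ := Nat.exists_eq_add_of_le hj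
    have h := isHomogeneousIdeal_iff.1 hJ _ hp (e + i)
    rw [hrp, map_add, homogeneousComponent_mul_of_isHomogeneous hx] at h
    refine (J.add_mem_iff_left (J.mul_mem_left _ ?_)).1 h
    exact ih i (by omega) (c * p) (by rw [mul_left_comm]; exact J.mul_mem_left _ hp)

end BasicDoubleLink
end

noncomputable section

namespace BasicDoubleLink

open MvPolynomial

variable {n : ℕ} {K : Type u} [Field K]

local notation "𝓡" => MvPolynomial (Fin (n + 1)) K

/-! ### Dimension, height and depth -/

lemma ringKrullDim_quotient_add_one_le_of_lt {A : Type u} [CommRing A] {P Q : Ideal A}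
    (hP : P.IsPrime) (h : P < Q) : ringKrullDim (A ⧸ Q) + 1 ≤ ringKrullDim (A ⧸ P) := by
  obtain ⟨x, hxQ, hxP⟩ := SetLike.exists_of_lt h
  refine ringKrullDim_succ_le_of_surjective (Ideal.Quotient.factor h.le)
    (Ideal.Quotient.factor_surjective h.le) (r := Ideal.Quotient.mk P x)
    (mem_nonZeroDivisors_of_ne_zero ?_) ?_
  · rwa [Ne, Ideal.Quotient.eq_zero_iff_mem]
  · rwa [Ideal.Quotient.factor_mk, Ideal.Quotient.eq_zero_iff_mem]

lemma ringKrullDim_quotient_anti {A : Type u} [CommRing A] {I J : Ideal A} (h : I ≤ J) :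
    ringKrullDim (A ⧸ J) ≤ ringKrullDim (A ⧸ I) :=
  ringKrullDim_le_of_surjective _ (Ideal.Quotient.factor_surjective h)

/-- Let `N = J : P`. If `N ⊆ J + (x)`, regularity of `x` gives `N ⊆ J + xN`, and a graded Nakayama
argument yields `N ⊆ J`, which is false because `P` is associated. So some `q ∈ N` lies outside `J +
(x)`; an associated prime containing its annihilator modulo `J + (x)` contains `P` and `x`. -/
lemma IsRegularMod.exists_associatedPrime_sup_span {J : Ideal 𝓡} (hJ : IsHomogeneousIdeal J) {x : 𝓡}
    (hx : IsRegularMod J x) {e : ℕ} (he : 0 < e) (hxe : x.IsHomogeneous e) {P : Ideal 𝓡}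
    (hP : P ∈ associatedPrimes 𝓡 (𝓡 ⧸ J)) :
    ∃ Q ∈ associatedPrimes 𝓡 (𝓡 ⧸ (J ⊔ Ideal.span {x})), P ≤ Q ∧ x ∈ Q := by
  obtain ⟨hPp, p, hp⟩ := mem_associatedPrimes_quotient_iff.1 hP
  let N : Ideal 𝓡 := J.colon (P : Set 𝓡)
  have hN : ∀ q, q ∈ N ↔ ∀ a ∈ P, q * a ∈ J := fun q => Submodule.mem_colon
  have hq : ∃ q ∈ N, q ∉ J ⊔ Ideal.span {x} := by
    by_contra! hc
    have hle : N ≤ J ⊔ Ideal.span {x} • N := by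
      intro q hq
      obtain ⟨a, ha, b, hb, rfl⟩ := Submodule.mem_sup.1 (hc q hq)
      obtain ⟨c, rfl⟩ := Ideal.mem_span_singleton'.1 hb
      refine Submodule.add_mem_sup ha ?_
      rw [mul_comm]
      refine Ideal.mul_mem_mul (Ideal.mem_span_singleton_self x) ((hN c).2 fun t ht => hx _ ?_)
      have h₁ := (J.add_mem_iff_right (J.mul_mem_right t ha)).1
        (by rw [← add_mul]; exact (hN _).1 hq t ht)
      rwa [mul_comm c x, mul_assoc] at h₁
    -- Nakayama gives `rN ⊆ J` with `r ≡ 1` modulo `x`, and such an `r` is a nonzerodivisor modulo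
    -- the homogeneous ideal `J`.
    obtain ⟨r, hr, hrN⟩ := Submodule.exists_sub_one_mem_and_smul_le_of_fg_of_le_sup
      (IsNoetherian.noetherian N) le_rfl hle
    have hpN : p ∈ N := (hN p).2 fun a ha => by rw [mul_comm]; exact (hp a).1 ha
    have hpJ : p ∈ J := isRegularMod_of_sub_one_mem hJ he hxe hr p
      (hrN (Submodule.smul_mem_pointwise_smul p r N hpN))
    exact hPp.ne_top ((Ideal.eq_top_iff_one _).2 ((hp 1).2 (by rwa [one_mul])))
  obtain ⟨q, hqN, hqJ⟩ := hq
  obtain ⟨Q, hQ, hle⟩ := exists_le_isAssociatedPrime_of_isNoetherianRing 𝓡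
    (Ideal.Quotient.mk (J ⊔ Ideal.span {x}) q) (by rwa [Ne, Ideal.Quotient.eq_zero_iff_mem])
  have hle' : ∀ a, a * q ∈ J ⊔ Ideal.span {x} → a ∈ Q := fun a ha =>
    hle (Submodule.mem_colon_singleton.2 ((Submodule.mem_bot _).2
      (Ideal.Quotient.eq_zero_iff_mem.2 ha)))
  refine ⟨Q, hQ, fun a ha => hle' a (Ideal.mem_sup_left ?_), hle' x (Ideal.mem_sup_right
    (Ideal.mul_mem_right _ _ (Ideal.mem_span_singleton_self x)))⟩
  rw [mul_comm]
  exact (hN q).1 hqN a ha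

/-- The depth is at most the dimension of each associated prime. -/
lemma ExtVanishing.le_ringKrullDim {J : Ideal 𝓡} (hJ : IsHomogeneousIdeal J) {s : ℕ}
    (h : ExtVanishing (irrelevant n K) (𝓡 ⧸ J) s) {P : Ideal 𝓡}
    (hP : P ∈ associatedPrimes 𝓡 (𝓡 ⧸ J)) : (s : WithBot ℕ∞) ≤ ringKrullDim (𝓡 ⧸ P) := by
  induction s generalizing J P with
  | zero =>
    have := hP.isPrime
    exact_mod_cast ringKrullDim_nonneg_of_nontrivial
  | succ s ih =>
    obtain ⟨e, he, x, hxe, hx⟩ := h.exists_isRegularMod hJ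
    obtain ⟨Q, hQ, hPQ, hxQ⟩ := hx.exists_associatedPrime_sup_span hJ he hxe hP
    -- `x` lies in `Q` but, being regular modulo `J`, not in `P`; so each cut raises the prime
    -- strictly and costs one degree of vanishing.
    have hlt : P < Q := lt_of_le_of_ne hPQ fun heq => by
      obtain ⟨hPp, p, hp⟩ := mem_associatedPrimes_quotient_iff.1 hP
      have : p ∈ J := hx p ((hp x).1 (heq ▸ hxQ))
      exact hPp.ne_top ((Ideal.eq_top_iff_one _).2 ((hp 1).2 (by rwa [one_mul])))
    refine le_trans ?_ (ringKrullDim_quotient_add_one_le_of_lt hP.isPrime hlt)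
    push_cast
    gcongr
    exact ih (hJ.sup (isHomogeneousIdeal_span_singleton hxe)) (h.sup_span hx) hQ

/-- A minimal prime of `J` below `P` is associated to `A/J`, hence misses `x` and is strictly below
`P`. -/
lemma IsRegularMod.height_add_one_le {A : Type u} [CommRing A] [IsNoetherianRing A] {J : Ideal A}
    {x : A} (hx : IsRegularMod J x) {P : Ideal A} (hP : P.IsPrime) (hJP : J ≤ P) (hxP : x ∈ P) :
    J.height + 1 ≤ P.height := by
  obtain ⟨Q, hQ, hQP⟩ := Ideal.exists_minimalPrimes_le hJP
  have hQp := hQ.isPrime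
  have hQa : Q ∈ associatedPrimes A (A ⧸ J) :=
    Module.associatedPrimes.minimalPrimes_annihilator_subset_associatedPrimes A (A ⧸ J)
      (by rwa [Ideal.annihilator_quotient])
  obtain ⟨-, p, hp⟩ := mem_associatedPrimes_quotient_iff.1 hQa
  have hxQ : x ∉ Q := fun h => by
    have : p ∈ J := hx p ((hp x).1 h)
    exact hQp.ne_top ((Ideal.eq_top_iff_one _).2 ((hp 1).2 (by rwa [one_mul])))
  have hlt : Q < P := lt_of_le_of_ne hQP fun h => hxQ (h ▸ hxP)
  exact (add_le_add_left (Ideal.height_mono hQ.1.2) 1).trans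
    (Ideal.height_add_one_le_of_lt_of_isPrime hlt)

lemma IsRegularMod.height_add_one_le_height_sup {A : Type u} [CommRing A] [IsNoetherianRing A]
    {J : Ideal A} {x : A} (hx : IsRegularMod J x) :
    J.height + 1 ≤ (J ⊔ Ideal.span {x}).height := by
  rw [(J ⊔ Ideal.span {x}).height_eq_inf_minimalPrimes]
  refine le_iInf₂ fun P hP => hx.height_add_one_le hP.isPrime (le_sup_left.trans hP.1.2) ?_
  exact hP.1.2 (Ideal.mem_sup_right (Ideal.mem_span_singleton_self x))

/-- A chain of length `d` of primes over `I` starts at a prime of height at least `I.height` and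
coheight at least `d`. -/
lemma height_add_ringKrullDim_quotient_le {A : Type u} [CommRing A] [Nontrivial A] (I : Ideal A)
    {d : ℕ} (hd : (d : WithBot ℕ∞) ≤ ringKrullDim (A ⧸ I)) :
    ((I.height + d : ℕ∞) : WithBot ℕ∞) ≤ ringKrullDim A := by
  rw [ringKrullDim_quotient, Order.le_krullDim_iff] at hd
  obtain ⟨l, rfl⟩ := hd
  have hIh : I.height ≤ Order.height l.head.1 := by
    rw [← PrimeSpectrum.height_eq_orderHeight]
    exact Ideal.height_mono l.head.2
  have hl : (l.length : ℕ∞) ≤ Order.coheight l.head.1 :=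
    Order.length_le_coheight (p := l.map Subtype.val fun _ _ h => h) le_rfl
  refine le_trans ?_ (Order.krullDim_eq_iSup_height_add_coheight_of_nonempty).ge
  norm_cast
  exact (add_le_add hIh hl).trans (le_iSup (fun a => Order.height a + Order.coheight a) l.head.1)

/-! ### The dimension formula for the polynomial ring -/

variable (n K) in
lemma ringKrullDim_eq : ringKrullDim 𝓡 = ((n + 1 : ℕ) : WithBot ℕ∞) := by
  simp

/-- Membership in an ideal spanned by variables is tested on monomials: a variable `X i` with `i <
k` dividing `X k * m` already divides `m`. -/
lemma isRegularMod_X (k : ℕ) (hk : k < n + 1) :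
    IsRegularMod (Ideal.span (X '' {i : Fin (n + 1) | (i : ℕ) < k}) : Ideal 𝓡) (X (⟨k, hk⟩ : Fin (n + 1))) := by
  intro p hp
  rw [mem_ideal_span_X_image] at hp ⊢
  intro m hm
  have hm' : Finsupp.single (⟨k, hk⟩ : Fin (n + 1)) 1 + m ∈ (X (⟨k, hk⟩ : Fin (n + 1)) * p).support := by
    rw [mem_support_iff, coeff_X_mul]
    exact mem_support_iff.1 hm
  obtain ⟨i, hi, hmi⟩ := hp _ hm'
  refine ⟨i, hi, ?_⟩
  have hne : (⟨k, hk⟩ : Fin (n + 1)) ≠ i := fun h => by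
    rw [← h] at hi
    exact lt_irrefl k hi
  simpa [Finsupp.single_apply, hne] using hmi

variable (n K) in
-- The variables form a regular sequence. The induction starts from `R/(x_0, ..., x_n)` and removes
-- one variable at a time, gaining a degree of vanishing; `j` counts the variables already removed.
lemma extVanishing_bot : ExtVanishing (irrelevant n K) (𝓡 ⧸ (⊥ : Ideal 𝓡)) (n + 1) := by
  have key : ∀ j k : ℕ, j + k = n + 1 → ExtVanishing (irrelevant n K)
      (𝓡 ⧸ (Ideal.span (X '' {i : Fin (n + 1) | (i : ℕ) < k}) : Ideal 𝓡)) j := by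
    intro j
    induction j with
    | zero => exact fun _ _ i hi => absurd hi (Nat.not_lt_zero i)
    | succ j ih =>
      intro k hk
      refine ExtVanishing.of_sup_span (mem_irrelevant_of_isHomogeneous
        (isHomogeneous_X K (⟨k, by omega⟩ : Fin (n + 1))) one_pos)
        (isRegularMod_X k (by omega)) ?_
      have h : (Ideal.span (X '' {i : Fin (n + 1) | (i : ℕ) < k}) : Ideal 𝓡) ⊔
          Ideal.span {X (⟨k, by omega⟩ : Fin (n + 1))} = Ideal.span (X '' {i : Fin (n + 1) | (i : ℕ) < k + 1}) := by
        rw [← Ideal.span_union, ← Set.image_singleton, ← Set.image_union]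
        congr 2
        ext i
        simp only [Set.mem_union, Set.mem_ofPred_eq, Set.mem_singleton_iff, Fin.ext_iff]
        omega
      rw [h]
      exact ih (k + 1) (by omega)
  have h := key (n + 1) 0 rfl
  have h₀ : (Ideal.span (X '' {i : Fin (n + 1) | (i : ℕ) < 0}) : Ideal 𝓡) = ⊥ := by simp
  rwa [h₀] at h

lemma IsHomogeneousIdeal.le_irrelevant {I : Ideal 𝓡} (hI : IsHomogeneousIdeal I) (hI' : I ≠ ⊤) :
    I ≤ irrelevant n K := by
  intro p hp
  have h := isHomogeneousIdeal_iff.1 hI p hp 0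
  rw [homogeneousComponent_zero] at h
  rw [irrelevant, ← Set.image_univ, mem_ideal_span_X_image]
  intro m hm
  by_contra! hc
  obtain rfl : m = 0 := Finsupp.ext fun i => hc i (Set.mem_univ i)
  exact hI' (Ideal.eq_top_of_isUnit_mem _ h
    ((isUnit_iff_ne_zero.2 (mem_support_iff.1 hm)).map C))

/-- `J` is enlarged by regular elements of `I`, trading a degree of vanishing for a unit of height.
The process stops at `j = 0`, or when `I` lies in an associated prime `Q` of `R/J`; then `dim R/I ≥
dim R/Q ≥ j`. -/
lemma exists_le_height_of_le {I : Ideal 𝓡} (hI : IsHomogeneousIdeal I)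
    (hI' : I ≠ ⊤) (j : ℕ) : ∀ (k : ℕ) (J : Ideal 𝓡), j + k = n + 1 → IsHomogeneousIdeal J → J ≤ I →
      (k : ℕ∞) ≤ J.height → ExtVanishing (irrelevant n K) (𝓡 ⧸ J) j →
      ∃ k j : ℕ, j + k = n + 1 ∧ (k : ℕ∞) ≤ I.height ∧
        (j : WithBot ℕ∞) ≤ ringKrullDim (𝓡 ⧸ I) := by
  induction j with
  | zero =>
    intro k J hk hJ hJI hkJ hext
    refine ⟨k, 0, hk, hkJ.trans (Ideal.height_mono hJI), ?_⟩
    have : Nontrivial (𝓡 ⧸ I) := Ideal.Quotient.nontrivial_iff.2 hI'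
    exact_mod_cast ringKrullDim_nonneg_of_nontrivial
  | succ j ih =>
    intro k J hk hJ hJI hkJ hext
    by_cases h : ∃ Q ∈ associatedPrimes 𝓡 (𝓡 ⧸ J), I ≤ Q
    · obtain ⟨Q, hQ, hIQ⟩ := h
      exact ⟨k, j + 1, hk, hkJ.trans (Ideal.height_mono hJI),
        (hext.le_ringKrullDim hJ hQ).trans (ringKrullDim_quotient_anti hIQ)⟩
    · push Not at h
      obtain ⟨e, -, x, hxI, hxe, hx⟩ :=
        exists_isHomogeneous_isRegularMod hJ hI (hI.le_irrelevant hI') h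
      refine ih (k + 1) (J ⊔ Ideal.span {x}) (by omega)
        (hJ.sup (isHomogeneousIdeal_span_singleton hxe))
        (sup_le hJI ((Ideal.span_singleton_le_iff_mem I).2 hxI)) ?_ (hext.sup_span hx)
      push_cast
      exact (add_le_add_left hkJ 1).trans hx.height_add_one_le_height_sup

/-- The dimension formula for homogeneous ideals of the polynomial ring. -/
lemma exists_height_eq_and_ringKrullDim_eq {I : Ideal 𝓡} (hI : IsHomogeneousIdeal I)
    (hI' : I ≠ ⊤) : ∃ h d : ℕ, d + h = n + 1 ∧ I.height = h ∧
      ringKrullDim (𝓡 ⧸ I) = d := by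
  obtain ⟨k, j, hjk, hk, hj⟩ := exists_le_height_of_le hI hI' (n + 1) 0 ⊥ rfl
    (isHomogeneousIdeal_iff.2 fun p hp j => by simp [(Submodule.mem_bot _).1 hp]) bot_le
    (by simp) (extVanishing_bot n K)
  -- The general bound `height + dim ≤ n + 1` turns the two lower bounds `k` and `j`, whose sum is
  -- `n + 1`, into equalities.
  have key : ∀ d : ℕ, (d : WithBot ℕ∞) ≤ ringKrullDim (𝓡 ⧸ I) → I.height + d ≤ (n + 1 : ℕ) :=
    fun d hd => by
      have := (height_add_ringKrullDim_quotient_le I hd).trans (ringKrullDim_eq n K).le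
      exact_mod_cast this
  have hfin : I.height ≠ ⊤ := fun h => by
    have := key j hj
    rw [h, top_add] at this
    exact absurd this (by simp)
  obtain ⟨h, hh⟩ := ENat.ne_top_iff_exists.1 hfin
  rw [← hh] at hk key
  have hk' : k ≤ h := by exact_mod_cast hk
  have key' : ∀ d : ℕ, (d : WithBot ℕ∞) ≤ ringKrullDim (𝓡 ⧸ I) → h + d ≤ n + 1 := fun d hd => by
    exact_mod_cast key d hd
  have h₁ := key' j hj
  refine ⟨k, j, hjk, ?_, le_antisymm (le_of_not_gt fun hlt => ?_) hj⟩
  · rw [← hh]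
    exact_mod_cast (by omega : h = k)
  · have h₂ := key' (j + 1) (by
      obtain ⟨e, he⟩ := WithBot.ne_bot_iff_exists.1 (ne_bot_of_gt hlt)
      rw [← he] at hlt ⊢
      have : (j : ℕ∞) < e := by exact_mod_cast hlt
      exact_mod_cast Order.add_one_le_of_lt this)
    omega

end BasicDoubleLink
end

noncomputable section

namespace BasicDoubleLink

/-! ### The long exact sequence of right derived functors -/

section Horseshoe

open Limits

variable {C : Type*} [Category* C] [Abelian C]

lemma exact_of_eq {X Y Z : C} {f : X ⟶ Y} {g g' : Y ⟶ Z} {w : f ≫ g = 0} (w' : f ≫ g' = 0)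
    (hg : g = g') (h : (ShortComplex.mk f g w).Exact) : (ShortComplex.mk f g' w').Exact := by
  subst hg
  exact h

/-- An injective resolution from an exact complex `0 → Z → M⁰ → M¹ → ⋯`. -/
def injectiveResolutionOfExact {Z : C} (M : CochainComplex C ℕ) (hM : ∀ i, Injective (M.X i))
    (ι : Z ⟶ M.X 0) (hι : Mono ι) (w : ι ≫ M.d 0 1 = 0)
    (h₀ : (ShortComplex.mk ι (M.d 0 1) w).Exact)
    (h : ∀ i, M.ExactAt (i + 1)) : InjectiveResolution Z where
  cocomplex := M
  ι := (CochainComplex.fromSingle₀Equiv _ _).symm ⟨ι, w⟩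
  quasiIso := ⟨fun i => by
    cases i
    · rw [CochainComplex.quasiIsoAt₀_iff, ShortComplex.quasiIso_iff_of_zeros]
      · refine (ShortComplex.exact_and_mono_f_iff_of_iso ?_).2 ⟨h₀, inferInstanceAs (Mono ι)⟩
        exact ShortComplex.isoMk (Iso.refl _) (Iso.refl _) (Iso.refl _)
          (by
            change 𝟙 Z ≫ ι = ((CochainComplex.fromSingle₀Equiv M Z).symm ⟨ι, w⟩).f 0 ≫ 𝟙 _
            rw [CochainComplex.fromSingle₀Equiv_symm_apply_f_zero]
            exact (Category.id_comp _).trans (Category.comp_id _).symm)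
          ((Category.id_comp _).trans (Category.comp_id _).symm)
      · rfl
      · rfl
      · exact M.shape _ _ (by simp)
    · rw [quasiIsoAt_iff_exactAt]
      · apply h
      · apply CochainComplex.exactAt_succ_single_obj⟩

lemma injectiveResolutionOfExact_ι_f_zero {Z : C} (M : CochainComplex C ℕ)
    (hM : ∀ i, Injective (M.X i)) (ι : Z ⟶ M.X 0) (hι : Mono ι) (w : ι ≫ M.d 0 1 = 0)
    (h₀ : (ShortComplex.mk ι (M.d 0 1) w).Exact) (h : ∀ i, M.ExactAt (i + 1)) :
    (injectiveResolutionOfExact M hM ι hι w h₀ h).ι.f 0 = ι :=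
  CochainComplex.fromSingle₀Equiv_symm_apply_f_zero ι w

/-- The augmentation of an injective resolution. -/
def augmentation {Z : C} (I : InjectiveResolution Z) : Z ⟶ I.cocomplex.X 0 := I.ι.f 0

instance {Z : C} (I : InjectiveResolution Z) : Mono (augmentation I) :=
  inferInstanceAs (Mono (I.ι.f 0))

lemma augmentation_comp_d {Z : C} (I : InjectiveResolution Z) :
    augmentation I ≫ I.cocomplex.d 0 1 = 0 :=
  I.ι_f_zero_comp_complex_d

lemma augmentation_exact {Z : C} (I : InjectiveResolution Z) :
    (ShortComplex.mk (augmentation I) (I.cocomplex.d 0 1) (augmentation_comp_d I)).Exact :=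
  I.exact₀

/-- The sign is the one that makes the differential of the twisted sum below square to zero. -/
lemma exists_anticommuting_extension {X Y Z W V : C} [Injective V] {f : X ⟶ Y} {g : Y ⟶ Z}
    {w : f ≫ g = 0} (h : (ShortComplex.mk f g w).Exact) (t : Y ⟶ W) (d : W ⟶ V)
    (ht : f ≫ t ≫ d = 0) : ∃ t' : Z ⟶ V, t ≫ d + g ≫ t' = 0 := by
  refine ⟨-h.descToInjective (t ≫ d) ht, ?_⟩
  have := h.comp_descToInjective (t ≫ d) ht
  dsimp only at this
  rw [Preadditive.comp_neg, this, add_neg_cancel]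

variable {S : ShortComplex C}

/-- `σ` extends the augmentation of `X₁` to `X₂`. The map `σ ≫ d` need not vanish but factors
through `X₃`; `τ 0` extends the negative of that factor, and each later `τ` exists because the terms
of `I` are injective and `K` is exact. -/
lemma exists_horseshoe_twist (hS : S.ShortExact) (I : InjectiveResolution S.X₁)
    (K : InjectiveResolution S.X₃) : ∃ (σ : S.X₂ ⟶ I.cocomplex.X 0)
    (τ : ∀ i, K.cocomplex.X i ⟶ I.cocomplex.X (i + 1)),
    S.f ≫ σ = augmentation I ∧ σ ≫ I.cocomplex.d 0 1 + S.g ≫ augmentation K ≫ τ 0 = 0 ∧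
    ∀ i, τ i ≫ I.cocomplex.d (i + 1) (i + 1 + 1) + K.cocomplex.d i (i + 1) ≫ τ (i + 1) = 0 := by
  have := hS.mono_f
  have := hS.epi_g
  let σ := Injective.factorThru (augmentation I) S.f
  have hσ : S.f ≫ σ = augmentation I := Injective.comp_factorThru _ _
  have hσ' : S.f ≫ σ ≫ I.cocomplex.d 0 1 = 0 := by
    rw [reassoc_of% hσ, augmentation_comp_d]
  let θ : S.X₃ ⟶ I.cocomplex.X 1 := hS.exact.desc (σ ≫ I.cocomplex.d 0 1) hσ'
  have hθ : S.g ≫ θ = σ ≫ I.cocomplex.d 0 1 := hS.exact.g_desc _ _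
  have hθ' : θ ≫ I.cocomplex.d 1 2 = 0 := by
    rw [← cancel_epi S.g, reassoc_of% hθ]
    simp
  let τ₀ := Injective.factorThru (-θ) (augmentation K)
  have hτ₀ : augmentation K ≫ τ₀ = -θ := Injective.comp_factorThru _ _
  obtain ⟨τ₁, hτ₁⟩ := exists_anticommuting_extension (augmentation_exact K) τ₀
    (I.cocomplex.d 1 2) (by rw [reassoc_of% hτ₀, Preadditive.neg_comp, hθ', neg_zero])
  -- The recursion carries two consecutive twists with their relation, since the next extension
  -- exists only because of that relation.
  have step : ∀ (i : ℕ) (p : {p : (K.cocomplex.X i ⟶ I.cocomplex.X (i + 1)) ×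
      (K.cocomplex.X (i + 1) ⟶ I.cocomplex.X (i + 1 + 1)) //
        p.1 ≫ I.cocomplex.d (i + 1) (i + 1 + 1) + K.cocomplex.d i (i + 1) ≫ p.2 = 0}),
      ∃ t : K.cocomplex.X (i + 1 + 1) ⟶ I.cocomplex.X (i + 1 + 1 + 1),
        p.1.2 ≫ I.cocomplex.d (i + 1 + 1) (i + 1 + 1 + 1) +
          K.cocomplex.d (i + 1) (i + 1 + 1) ≫ t = 0 := by
    rintro i ⟨⟨t, t'⟩, h⟩
    refine exists_anticommuting_extension (K.exact_succ i) t' _ ?_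
    dsimp only at h ⊢
    have h' : K.cocomplex.d i (i + 1) ≫ t' = -(t ≫ I.cocomplex.d (i + 1) (i + 1 + 1)) :=
      eq_neg_of_add_eq_zero_right h
    rw [reassoc_of% h']
    simp
  choose nxt hnxt using step
  let seq : ∀ i, {p : (K.cocomplex.X i ⟶ I.cocomplex.X (i + 1)) ×
      (K.cocomplex.X (i + 1) ⟶ I.cocomplex.X (i + 1 + 1)) //
        p.1 ≫ I.cocomplex.d (i + 1) (i + 1 + 1) + K.cocomplex.d i (i + 1) ≫ p.2 = 0} := fun i =>
    Nat.rec ⟨(τ₀, τ₁), hτ₁⟩ (fun i p => ⟨(p.1.2, nxt i p), hnxt i p⟩) i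
  refine ⟨σ, fun i => (seq i).1.1, hσ, ?_, fun i => (seq i).2⟩
  change _ + S.g ≫ augmentation K ≫ τ₀ = 0
  rw [hτ₀, Preadditive.comp_neg, hθ, add_neg_cancel]

/-! ### Twisted sums of complexes -/

section twistedSum

variable (A B : CochainComplex C ℕ) (τ : ∀ i, B.X i ⟶ A.X (i + 1))

/-- The differential of a twisted sum. -/
abbrev twistedSumD (i : ℕ) : A.X i ⊞ B.X i ⟶ A.X (i + 1) ⊞ B.X (i + 1) :=
  biprod.desc (A.d i (i + 1) ≫ biprod.inl) (τ i ≫ biprod.inl + B.d i (i + 1) ≫ biprod.inr)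

variable (hτ : ∀ i, τ i ≫ A.d (i + 1) (i + 1 + 1) + B.d i (i + 1) ≫ τ (i + 1) = 0)

/-- The twisted direct sum of two complexes. -/
def twistedSum : CochainComplex C ℕ :=
  CochainComplex.of (fun i => A.X i ⊞ B.X i) (twistedSumD A B τ) fun i => by
    ext
    · simp
    · simp
    · simpa using hτ i
    · simp

lemma twistedSum_d (i : ℕ) : (twistedSum A B τ hτ).d i (i + 1) = twistedSumD A B τ i :=
  CochainComplex.of_d (fun i => A.X i ⊞ B.X i) (twistedSumD A B τ) i

/-- The inclusion of the subcomplex into the twisted sum. -/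
def twistedSumInl : A ⟶ twistedSum A B τ hτ where
  f i := (biprod.inl : A.X i ⟶ A.X i ⊞ B.X i)
  comm' i j hij := by
    obtain rfl : i + 1 = j := hij
    rw [twistedSum_d]
    exact biprod.inl_desc _ _

lemma twistedSumD_snd (i : ℕ) :
    biprod.snd ≫ B.d i (i + 1) = twistedSumD A B τ i ≫ biprod.snd := by
  ext <;> simp

/-- The projection of the twisted sum to the quotient complex. -/
def twistedSumSnd : twistedSum A B τ hτ ⟶ B where
  f i := (biprod.snd : A.X i ⊞ B.X i ⟶ B.X i)
  comm' i j hij := by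
    obtain rfl : i + 1 = j := hij
    rw [twistedSum_d]
    exact twistedSumD_snd A B τ i

/-- The short complex formed by a twisted sum. -/
abbrev twistedSumShortComplex : ShortComplex (CochainComplex C ℕ) :=
  ShortComplex.mk (twistedSumInl A B τ hτ) (twistedSumSnd A B τ hτ) (by
    ext i
    exact biprod.inl_snd)

/-- The degreewise splitting of a twisted sum. -/
def twistedSumSplitting (i : ℕ) : ((twistedSumShortComplex A B τ hτ).map
    (HomologicalComplex.eval C _ i)).Splitting where
  r := (biprod.fst : A.X i ⊞ B.X i ⟶ A.X i)
  s := (biprod.inr : B.X i ⟶ A.X i ⊞ B.X i)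
  f_r := biprod.inl_fst
  s_g := biprod.inr_snd
  id := biprod.total

lemma twistedSumShortComplex_shortExact : (twistedSumShortComplex A B τ hτ).ShortExact :=
  HomologicalComplex.shortExact_of_degreewise_shortExact _
    fun i => (twistedSumSplitting A B τ hτ i).shortExact

end twistedSum

section

variable {I₀ I₁ K₀ K₁ : C} {i₀ : S.X₁ ⟶ I₀} {dI : I₀ ⟶ I₁} {κ : S.X₃ ⟶ K₀} {dK : K₀ ⟶ K₁}
    {wI : i₀ ≫ dI = 0} {wK : κ ≫ dK = 0} {σ : S.X₂ ⟶ I₀} {τ : K₀ ⟶ I₁}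

lemma horseshoe_zero (wK : κ ≫ dK = 0) (h : σ ≫ dI + S.g ≫ κ ≫ τ = 0) :
    biprod.lift σ (S.g ≫ κ) ≫ biprod.desc (dI ≫ biprod.inl)
      (τ ≫ biprod.inl + dK ≫ biprod.inr) = 0 := by
  apply biprod.hom_ext
  · simpa [biprod.lift_desc] using h
  · simp [biprod.lift_desc, wK]

lemma horseshoe_mono (hS : S.ShortExact) [Mono i₀] [Mono κ] (hσ : S.f ≫ σ = i₀) :
    Mono (biprod.lift σ (S.g ≫ κ)) := by
  have := hS.mono_f
  refine Preadditive.mono_of_cancel_zero _ fun {T} x hx => ?_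
  have h₁ : x ≫ σ = 0 := by simpa using hx =≫ biprod.fst
  have h₂ : x ≫ S.g = 0 := by
    rw [← cancel_mono κ]
    simpa using hx =≫ biprod.snd
  have h₃ : hS.exact.lift x h₂ ≫ S.f = x := hS.exact.lift_f x h₂
  have h₄ : hS.exact.lift x h₂ = 0 := by
    rw [← cancel_mono i₀, zero_comp, ← hσ, reassoc_of% h₃, h₁]
  rw [← h₃, h₄, zero_comp]

lemma horseshoe_comm (hσ : S.f ≫ σ = i₀) :
    i₀ ≫ biprod.inl = S.f ≫ biprod.lift σ (S.g ≫ κ) := by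
  apply biprod.hom_ext <;> simp [hσ]

/-- Chase for a cocycle `(x₁, x₂)`: `x₂` comes from `X₃`, is lifted to `b` in `X₂` after a
refinement, and `x₁ - σ b` is then a cocycle of `I`, hence comes from `X₁`. -/
lemma horseshoe_exact (hS : S.ShortExact) [Mono i₀] [Mono κ] (hI : (ShortComplex.mk i₀ dI wI).Exact)
    (hK : (ShortComplex.mk κ dK wK).Exact) (hσ : S.f ≫ σ = i₀)
    (h : σ ≫ dI + S.g ≫ κ ≫ τ = 0) :
    (ShortComplex.mk _ _ (horseshoe_zero wK h)).Exact := by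
  have := hS.epi_g
  rw [ShortComplex.exact_iff_exact_up_to_refinements]
  intro T x hx
  dsimp only at x hx ⊢
  obtain ⟨x₁, x₂, rfl⟩ : ∃ x₁ x₂, x = biprod.lift x₁ x₂ :=
    ⟨x ≫ biprod.fst, x ≫ biprod.snd, by ext <;> simp⟩
  have e₁ : x₁ ≫ dI + x₂ ≫ τ = 0 := by simpa [biprod.lift_desc] using hx =≫ biprod.fst
  have e₂ : x₂ ≫ dK = 0 := by simpa [biprod.lift_desc] using hx =≫ biprod.snd
  obtain ⟨y, hy⟩ : ∃ y, y ≫ κ = x₂ := ⟨hK.lift x₂ e₂, hK.lift_f x₂ e₂⟩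
  obtain ⟨T', π, hπ, b, hb⟩ := surjective_up_to_refinements_of_epi S.g y
  have e₃ : (π ≫ x₁ - b ≫ σ) ≫ dI = 0 := by
    rw [Preadditive.sub_comp, Category.assoc, Category.assoc, eq_neg_of_add_eq_zero_left e₁,
      eq_neg_of_add_eq_zero_left h, ← hy, Preadditive.comp_neg, Preadditive.comp_neg,
      ← reassoc_of% hb]
    simp
  obtain ⟨a, ha⟩ : ∃ a, a ≫ i₀ = π ≫ x₁ - b ≫ σ := ⟨hI.lift _ e₃, hI.lift_f _ e₃⟩
  refine ⟨T', π, hπ, b + a ≫ S.f, ?_⟩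
  apply biprod.hom_ext
  · simp [hσ, ha]
  · simp [← hy, reassoc_of% hb]

end

/-- The horseshoe lemma: resolutions of the outer terms of a short exact sequence are combined into
a resolution of the middle term. -/
def horseshoe (hS : S.ShortExact) (I : InjectiveResolution S.X₁)
    (K : InjectiveResolution S.X₃) (σ : S.X₂ ⟶ I.cocomplex.X 0)
    (τ : ∀ i, K.cocomplex.X i ⟶ I.cocomplex.X (i + 1)) (hσ : S.f ≫ σ = augmentation I)
    (h₀ : σ ≫ I.cocomplex.d 0 1 + S.g ≫ augmentation K ≫ τ 0 = 0)
    (hτ : ∀ i, τ i ≫ I.cocomplex.d (i + 1) (i + 1 + 1) +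
      K.cocomplex.d i (i + 1) ≫ τ (i + 1) = 0) : InjectiveResolution S.X₂ :=
  injectiveResolutionOfExact (twistedSum I.cocomplex K.cocomplex τ hτ)
    (fun i => inferInstanceAs (Injective (I.cocomplex.X i ⊞ K.cocomplex.X i)))
    (biprod.lift σ (S.g ≫ augmentation K))
    (horseshoe_mono hS hσ)
    (by
      rw [twistedSum_d]
      exact horseshoe_zero (augmentation_comp_d K) h₀)
    (by
      have h := horseshoe_exact hS (augmentation_exact I) (augmentation_exact K) hσ h₀
      exact exact_of_eq _ (twistedSum_d _ _ τ hτ 0).symm h)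
    (fun i => (twistedSumShortComplex_shortExact I.cocomplex K.cocomplex τ hτ).exactAt_X₂ (i + 1)
      (I.cocomplex_exactAt_succ i) (K.cocomplex_exactAt_succ i))

variable [HasInjectiveResolutions C]

/-- The degreewise splittings are recorded because an additive functor, though not exact, preserves
them. -/
lemma exists_shortExact_resolutions (hS : S.ShortExact) :
    ∃ (I : InjectiveResolution S.X₁) (L : InjectiveResolution S.X₂) (K : InjectiveResolution S.X₃)
      (φ : I.cocomplex ⟶ L.cocomplex) (ψ : L.cocomplex ⟶ K.cocomplex) (w : φ ≫ ψ = 0),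
      I.ι.f 0 ≫ φ.f 0 = S.f ≫ L.ι.f 0 ∧
      ∀ i, Nonempty (((ShortComplex.mk φ ψ w).map (HomologicalComplex.eval C _ i)).Splitting) := by
  obtain ⟨I⟩ := (HasInjectiveResolutions.out S.X₁).out
  obtain ⟨K⟩ := (HasInjectiveResolutions.out S.X₃).out
  obtain ⟨σ, τ, hσ, h₀, hτ⟩ := exists_horseshoe_twist hS I K
  refine ⟨I, horseshoe hS I K σ τ hσ h₀ hτ, K, twistedSumInl I.cocomplex K.cocomplex τ hτ,
    twistedSumSnd I.cocomplex K.cocomplex τ hτ,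
    (twistedSumShortComplex I.cocomplex K.cocomplex τ hτ).zero, ?_,
    fun i => ⟨twistedSumSplitting I.cocomplex K.cocomplex τ hτ i⟩⟩
  exact (horseshoe_comm hσ).trans
    (congrArg (S.f ≫ ·) (injectiveResolutionOfExact_ι_f_zero (twistedSum _ _ τ hτ) ..).symm)

variable {D : Type*} [Category* D] [Abelian D] (F : C ⥤ D) [F.Additive]

/-- A short exact sequence `0 → X₁ → X₂ → X₃ → 0` yields a short exact sequence of complexes which
compute the derived functors. -/
lemma exists_shortExact_rightDerived (hS : S.ShortExact) :
    ∃ (T : ShortComplex (CochainComplex D ℕ)) (_ : T.ShortExact)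
      (e₁ : ∀ i, (F.rightDerived i).obj S.X₁ ≅ T.X₁.homology i)
      (e₂ : ∀ i, (F.rightDerived i).obj S.X₂ ≅ T.X₂.homology i)
      (_ : ∀ i, (F.rightDerived i).obj S.X₃ ≅ T.X₃.homology i),
      ∀ i, (F.rightDerived i).map S.f =
        (e₁ i).hom ≫ HomologicalComplex.homologyMap T.f i ≫ (e₂ i).inv := by
  obtain ⟨I, L, K, φ, ψ, w, hφ, h⟩ := exists_shortExact_resolutions hS
  refine ⟨(ShortComplex.mk φ ψ w).map (F.mapHomologicalComplex (ComplexShape.up ℕ)),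
    HomologicalComplex.shortExact_of_degreewise_shortExact _
      fun i => ((h i).some.map F).shortExact,
    fun i => I.isoRightDerivedObj F i, fun i => L.isoRightDerivedObj F i,
    fun i => K.isoRightDerivedObj F i, fun i => ?_⟩
  have := InjectiveResolution.isoRightDerivedObj_hom_naturality S.f I L φ hφ F i
  exact ((Iso.eq_comp_inv (L.isoRightDerivedObj F i)).2 this).trans (Category.assoc ..)

/-- If `RⁱF` and `Rⁱ⁺¹F` vanish at the middle term of a short exact sequence, then the connecting
homomorphism is an isomorphism. -/
lemma nonempty_rightDerived_iso_succ (hS : S.ShortExact) (i : ℕ)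
    (h₀ : IsZero ((F.rightDerived i).obj S.X₂)) (h₁ : IsZero ((F.rightDerived (i + 1)).obj S.X₂)) :
    Nonempty ((F.rightDerived i).obj S.X₃ ≅ (F.rightDerived (i + 1)).obj S.X₁) := by
  obtain ⟨T, hT, e₁, e₂, e₃, -⟩ := exists_shortExact_rightDerived F hS
  exact ⟨e₃ i ≪≫ hT.δIso i (i + 1) rfl (h₀.of_iso (e₂ i).symm) (h₁.of_iso (e₂ (i + 1)).symm) ≪≫
    (e₁ (i + 1)).symm⟩

/-- No differential enters degree `0`, so homology there is the object of cycles, and taking cycles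
preserves monomorphisms. -/
lemma mono_rightDerived_zero_map (hS : S.ShortExact) : Mono ((F.rightDerived 0).map S.f) := by
  obtain ⟨T, hT, e₁, e₂, -, he⟩ := exists_shortExact_rightDerived F hS
  have := hT.mono_f
  have : Mono (HomologicalComplex.homologyMap T.f 0) := by
    have h : HomologicalComplex.homologyMap T.f 0 =
        (CochainComplex.isoHomologyπ₀ T.X₁).inv ≫ HomologicalComplex.cyclesMap T.f 0 ≫
          (CochainComplex.isoHomologyπ₀ T.X₂).hom := by
      rw [Iso.eq_inv_comp]
      exact HomologicalComplex.homologyπ_naturality T.f 0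
    rw [h]
    infer_instance
  rw [he]
  infer_instance

lemma mono_rightDerived_succ_map (hS : S.ShortExact) (i : ℕ)
    (h : IsZero ((F.rightDerived i).obj S.X₃)) : Mono ((F.rightDerived (i + 1)).map S.f) := by
  obtain ⟨T, hT, e₁, e₂, e₃, he⟩ := exists_shortExact_rightDerived F hS
  have : Mono (HomologicalComplex.homologyMap T.f (i + 1)) :=
    (hT.homology_exact₁ i (i + 1) rfl).mono_g ((h.of_iso (e₃ i).symm).eq_zero_of_src _)
  rw [he]
  infer_instance

end Horseshoe

end BasicDoubleLink
end

noncomputable section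

namespace BasicDoubleLink

/-! ### Shifts of graded modules -/

section Shift

open Limits

variable {n : ℕ} {K : Type u} [Field K]

/-- Degrees with the same underlying integer are isomorphic. -/
def degreesIso {a b : Degrees n} (h : a.deg = b.deg) : a ≅ b where
  hom := ⟨0, by simp [h]⟩
  inv := ⟨0, by simp [h]⟩
  hom_inv_id := Subtype.ext (add_zero (0 : Fin (n + 1) →₀ ℕ))
  inv_hom_id := Subtype.ext (add_zero (0 : Fin (n + 1) →₀ ℕ))

/-- Adding an integer to the degree is an equivalence. -/
def addDegreeEquivalence (n : ℕ) (e : ℤ) : Degrees n ≌ Degrees n :=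
  CategoryTheory.Equivalence.mk (addDegree n (-e)) (addDegree n e)
    (NatIso.ofComponents (fun a => degreesIso (by change a.deg = a.deg + -e + e; ring))
      fun s => Subtype.ext ((add_zero s.1).trans (zero_add s.1).symm))
    (NatIso.ofComponents (fun a => degreesIso (by change a.deg + e + -e = a.deg; ring))
      fun s => Subtype.ext ((add_zero s.1).trans (zero_add s.1).symm))

variable (n K) in
/-- The shift by `e` as a functor. -/
def degreeShift (e : ℤ) : GradedMod n K ⥤ GradedMod n K :=
  (Functor.whiskeringLeft _ _ _).obj (addDegree n e)

instance (e : ℤ) : (degreeShift n K e).IsEquivalence :=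
  inferInstanceAs ((addDegreeEquivalence n e).congrLeft (E := ModuleCat.{u} K)).functor.IsEquivalence

instance (e : ℤ) : (degreeShift n K e).Additive where
  map_add := rfl

/-- The shifts by `e` and `-e` cancel. -/
def shiftShiftNegIso (M : GradedMod n K) (e : ℤ) : shift (shift M e) (-e) ≅ M :=
  NatIso.ofComponents (fun a => M.mapIso (degreesIso (by change a.deg + -e + e = a.deg; ring)))
    fun {a b} s => by
      change M.map _ ≫ M.map _ = M.map _ ≫ M.map _
      rw [← M.map_comp, ← M.map_comp]
      exact congrArg _ (Subtype.ext ((add_zero s.1).trans (zero_add s.1).symm))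

lemma torsion_shift (M : GradedMod n K) (e : ℤ) (a : Degrees n) :
    torsion (shift M e) a = torsion M ((addDegree n e).obj a) := by
  ext m
  refine exists_congr fun k => ⟨fun h b s hs => ?_, fun h b s hs => h _ ((addDegree n e).map s) hs⟩
  -- A morphism out of `a + e` is, up to the identification of `b` with `(b - e) + e`, the shift of
  -- one out of `a`.
  let c : Degrees n := ⟨b.deg - e⟩
  have hc : b.deg = ((addDegree n e).obj c).deg := by change b.deg = b.deg - e + e; ring
  let t : a ⟶ c := ⟨s.1, eq_sub_of_add_eq ((add_right_comm _ _ _).trans s.2)⟩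
  have ht : s = (addDegree n e).map t ≫ (degreesIso hc).inv :=
    Subtype.ext (add_zero s.1).symm
  rw [ht, M.map_comp]
  exact (congrArg (M.map (degreesIso hc).inv) (h c t hs)).trans (map_zero _)

/-- Taking torsion commutes with shifts. -/
def torsionShiftIso (e : ℤ) :
    degreeShift n K e ⋙ torsionFunctor n K ≅ torsionFunctor n K ⋙ degreeShift n K e :=
  NatIso.ofComponents (fun M => NatIso.ofComponents
    (fun a => (LinearEquiv.ofEq _ _ (torsion_shift M e a)).toModuleIso) fun _ => rfl) fun _ => rfl

/-- The shift of an injective resolution. -/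
def shiftResolution {M : GradedMod n K} (I : InjectiveResolution M) (e : ℤ) :
    InjectiveResolution ((degreeShift n K e).obj M) :=
  injectiveResolutionOfExact
    (((degreeShift n K e).mapHomologicalComplex (ComplexShape.up ℕ)).obj I.cocomplex)
    (fun i => ((degreeShift n K e).asEquivalence.map_injective_iff (I.cocomplex.X i)).2 inferInstance)
    ((degreeShift n K e).map (augmentation I)) ((degreeShift n K e).map_mono (augmentation I))
    ((Functor.map_comp _ _ _).symm.trans
      ((congrArg _ (augmentation_comp_d I)).trans (Functor.map_zero _ _ _)))
    ((augmentation_exact I).map (degreeShift n K e))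
    (fun i => (I.cocomplex_exactAt_succ i).map (degreeShift n K e))

/-- Local cohomology commutes with shifts. -/
def localCohomologyShiftIso (i : ℕ) (M : GradedMod n K) (e : ℤ) :
    localCohomologyModule i (shift M e) ≅ shift (localCohomologyModule i M) e :=
  let I := (HasInjectiveResolutions.out M).out.some
  (shiftResolution I e).isoRightDerivedObj (torsionFunctor n K) i ≪≫
    (HomologicalComplex.homologyFunctor _ _ i).mapIso
      ((NatIso.mapHomologicalComplex (torsionShiftIso e) _).app I.cocomplex) ≪≫
    ((((torsionFunctor n K).mapHomologicalComplex _).obj I.cocomplex).sc i).mapHomologyIso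
      (degreeShift n K e) ≪≫
    (degreeShift n K e).mapIso (I.isoRightDerivedObj (torsionFunctor n K) i).symm

end Shift

end BasicDoubleLink
end

noncomputable section

namespace BasicDoubleLink

/-! ### Multiplication by forms on graded modules -/

section Multiplication

open Limits MvPolynomial

variable {n : ℕ} {K : Type u} [Field K]

local notation "𝓡" => MvPolynomial (Fin (n + 1)) K

/-- A monomial of a form of degree `e`, as a morphism of degrees. -/
def monomialHom {x : 𝓡} {e : ℕ} (hx : x.IsHomogeneous e) (a : Degrees n)
    (s : {s // s ∈ x.support}) : a ⟶ (addDegree n e).obj a :=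
  ⟨s.1, congrArg (a.deg + ·) (congrArg Nat.cast (by
    rw [hx.degree_eq_sum_deg_support s.2]; rfl))⟩

/-- Multiplication by a form `x` of degree `e` on the component of degree `a`. -/
def mulApp {x : 𝓡} {e : ℕ} (hx : x.IsHomogeneous e) (M : GradedMod n K) (a : Degrees n) :
    M.obj a ⟶ M.obj ((addDegree n e).obj a) :=
  ∑ s ∈ x.support.attach, x.coeff s.1 • M.map (monomialHom hx a s)

lemma mulApp_comp_map {x : 𝓡} {e : ℕ} (hx : x.IsHomogeneous e) (M : GradedMod n K)
    {a b : Degrees n} (t : a ⟶ b) :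
    M.map t ≫ mulApp hx M b = mulApp hx M a ≫ M.map ((addDegree n e).map t) := by
  rw [mulApp, mulApp, Preadditive.comp_sum, Preadditive.sum_comp]
  refine Finset.sum_congr rfl fun s _ => ?_
  rw [Linear.comp_smul, Linear.smul_comp, ← M.map_comp, ← M.map_comp]
  exact congrArg _ (congrArg _ (Subtype.ext (add_comm t.1 s.1)))

lemma mulApp_comp_app {x : 𝓡} {e : ℕ} (hx : x.IsHomogeneous e) {M N : GradedMod n K} (φ : M ⟶ N)
    (a : Degrees n) :
    φ.app a ≫ mulApp hx N a = mulApp hx M a ≫ φ.app ((addDegree n e).obj a) := by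
  rw [mulApp, mulApp, Preadditive.comp_sum, Preadditive.sum_comp]
  refine Finset.sum_congr rfl fun s _ => ?_
  rw [Linear.comp_smul, Linear.smul_comp, φ.naturality]

lemma mulApp_apply {x : 𝓡} {e : ℕ} (hx : x.IsHomogeneous e) (M : GradedMod n K)
    (a : Degrees n) (m : M.obj a) : mulApp hx M a m =
      ∑ s ∈ x.support.attach, x.coeff s.1 • M.map (monomialHom hx a s) m := by
  change (∑ s ∈ x.support.attach, x.coeff s.1 • M.map (monomialHom hx a s)).hom m = _
  rw [ModuleCat.hom_sum, LinearMap.sum_apply]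
  rfl

lemma mulApp_eq_zero {x : 𝓡} {e : ℕ} (hx : x.IsHomogeneous e) (M : GradedMod n K)
    (a : Degrees n) (m : M.obj a)
    (h : ∀ (b : Degrees n) (s : a ⟶ b), e ≤ s.1.degree → M.map s m = 0) :
    mulApp hx M a m = 0 := by
  rw [mulApp_apply]
  refine Finset.sum_eq_zero fun s _ => ?_
  have hs : e ≤ (monomialHom hx a s).1.degree := (hx.degree_eq_sum_deg_support s.2).le
  exact (congrArg _ (h _ _ hs)).trans (smul_zero _)

lemma mulApp_quotientModule {x : 𝓡} {e : ℕ} (hx : x.IsHomogeneous e) (J : Ideal 𝓡)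
    (a : Degrees n) (m : quotientPart J a.deg) :
    (quotientPart J (a.deg + e)).subtype (mulApp hx (quotientModule J) a m) =
      Ideal.Quotient.mk J x * m := by
  refine (congrArg (quotientPart J (a.deg + e)).subtype
    (mulApp_apply hx (quotientModule J) a m)).trans ?_
  refine (map_sum (quotientPart J (a.deg + e)).subtype _ _).trans ?_
  conv_rhs => rw [x.as_sum, ← Finset.sum_attach, map_sum, Finset.sum_mul]
  refine Finset.sum_congr rfl fun s _ => ?_
  change x.coeff s.1 • (Ideal.Quotient.mk J (monomial s.1 1) * (m : 𝓡 ⧸ J)) = _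
  rw [← smul_mul_assoc]
  congr 1
  conv_rhs => rw [← mul_one (x.coeff s.1), ← smul_eq_mul, ← smul_monomial]
  rfl

/-- Multiplication by a form `x` of degree `e`, as a natural transformation with components
`M ⟶ M(e)`. -/
def mulTrans {x : 𝓡} {e : ℕ} (hx : x.IsHomogeneous e) : 𝟭 (GradedMod n K) ⟶ degreeShift n K e where
  app M :=
    { app := mulApp hx M
      naturality _ _ t := mulApp_comp_map hx M t }
  naturality _ _ φ := NatTrans.ext (funext fun a => mulApp_comp_app hx φ a)

/-! ### Exactness for graded modules -/

lemma isZero_of_forall_isZero_obj {M : GradedMod n K} (h : ∀ a, ∀ m : M.obj a, m = 0) :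
    IsZero M :=
  Functor.isZero _ fun a =>
    have : Subsingleton (M.obj a) := ⟨fun m m' => (h a m).trans (h a m').symm⟩
    ModuleCat.isZero_of_subsingleton _

lemma exact_of_forall_app {S : ShortComplex (GradedMod n K)}
    (h : ∀ (a : Degrees n) (y : S.X₂.obj a), S.g.app a y = 0 → ∃ z, S.f.app a z = y) :
    S.Exact := by
  rw [ShortComplex.exact_iff_isZero_homology]
  refine Functor.isZero _ fun a => ?_
  refine IsZero.of_iso ?_ (S.mapHomologyIso ((evaluation (Degrees n) (ModuleCat.{u} K)).obj a)).symm
  rw [← ShortComplex.exact_iff_isZero_homology, ShortComplex.moduleCat_exact_iff]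
  exact h a

lemma shortExact_of_forall_app {S : ShortComplex (GradedMod n K)}
    (h₁ : ∀ (a : Degrees n) (z : S.X₁.obj a), S.f.app a z = 0 → z = 0)
    (h₂ : ∀ (a : Degrees n) (y : S.X₂.obj a), S.g.app a y = 0 → ∃ z, S.f.app a z = y)
    (h₃ : ∀ (a : Degrees n) (x : S.X₃.obj a), ∃ y, S.g.app a y = x) : S.ShortExact where
  exact := exact_of_forall_app h₂
  mono_f := by
    refine (NatTrans.mono_iff_mono_app _).2 fun a => ?_
    rw [ModuleCat.mono_iff_injective]
    exact (injective_iff_map_eq_zero _).2 (h₁ a)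
  epi_g := by
    refine (NatTrans.epi_iff_epi_app _).2 fun a => ?_
    rw [ModuleCat.epi_iff_surjective]
    exact h₃ a

lemma app_injective {M N : GradedMod n K} (φ : M ⟶ N) [Mono φ] (a : Degrees n) :
    Function.Injective (φ.app a) :=
  (ModuleCat.mono_iff_injective _).1 ((NatTrans.mono_iff_mono_app _).1 inferInstance a)

lemma eq_zero_of_app_eq_zero {M N : GradedMod n K} (φ : M ⟶ N) (hφ : Mono φ) {a : Degrees n}
    {m : M.obj a} (h : φ.app a m = 0) : m = 0 :=
  app_injective φ a (h.trans (map_zero _).symm)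

lemma app_apply_congr {M N : GradedMod n K} {φ ψ : M ⟶ N} (h : φ = ψ) (a : Degrees n)
    (m : M.obj a) : φ.app a m = ψ.app a m := by
  rw [h]

lemma app_surjective {M N : GradedMod n K} (φ : M ⟶ N) [Epi φ] (a : Degrees n) :
    Function.Surjective (φ.app a) :=
  (ModuleCat.epi_iff_surjective _).1 ((NatTrans.epi_iff_epi_app _).1 inferInstance a)

lemma exists_app_eq {S : ShortComplex (GradedMod n K)} (h : S.Exact) (a : Degrees n)
    (y : S.X₂.obj a) (hy : S.g.app a y = 0) : ∃ z, S.f.app a z = y :=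
  (ShortComplex.moduleCat_exact_iff _).1
    (h.map ((evaluation (Degrees n) (ModuleCat.{u} K)).obj a)) y hy

/-! ### Local cohomology is torsion -/

lemma homologyMap_app_eq_zero {X Y : CochainComplex (GradedMod n K) ℕ} (φ : X ⟶ Y) (i : ℕ)
    (a : Degrees n) (z : (X.cycles i).obj a) (hz : (φ.f i).app a ((X.iCycles i).app a z) = 0) :
    (HomologicalComplex.homologyMap φ i).app a ((X.homologyπ i).app a z) = 0 := by
  have h₁ : (HomologicalComplex.cyclesMap φ i).app a z = 0 := by
    apply app_injective (Y.iCycles i) a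
    rw [map_zero, ← hz]
    exact app_apply_congr (HomologicalComplex.cyclesMap_i φ i) a z
  have h₂ := app_apply_congr (HomologicalComplex.homologyπ_naturality φ i) a z
  exact h₂.trans ((congrArg ((Y.homologyπ i).app a) h₁).trans (map_zero _))

/-- Every class in local cohomology is annihilated by the forms of large degree. -/
lemma exists_rightDerived_mulTrans_eq_zero (i : ℕ) (M : GradedMod n K) (a : Degrees n)
    (c : (localCohomologyModule i M).obj a) : ∃ k : ℕ, ∀ (x : 𝓡) (e : ℕ) (hx : x.IsHomogeneous e),
      k ≤ e → (((torsionFunctor n K).rightDerived i).map ((mulTrans hx).app M)).app a c = 0 := by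
  obtain ⟨I⟩ := (HasInjectiveResolutions.out M).out
  let T := (torsionFunctor n K).mapHomologicalComplex (ComplexShape.up ℕ)
  obtain ⟨z, hz⟩ := app_surjective ((T.obj I.cocomplex).homologyπ i) a
    ((I.isoRightDerivedObj (torsionFunctor n K) i).hom.app a c)
  -- The class is represented by a cocycle in the torsion of `Iⁱ`, so a single `k` kills the
  -- representative.
  let m : torsion (I.cocomplex.X i) a := ((T.obj I.cocomplex).iCycles i).app a z
  obtain ⟨k, hk⟩ := m.2
  refine ⟨k, fun x e hx hke => ?_⟩
  -- Multiplication by `x` on the resolution lifts multiplication by `x` on `M`, so it computes the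
  -- derived map.
  let μ : I.cocomplex ⟶ (shiftResolution I e).cocomplex :=
    { f j := (mulTrans hx).app (I.cocomplex.X j)
      comm' j j' _ := ((mulTrans hx).naturality (I.cocomplex.d j j')).symm }
  have hμ : I.ι.f 0 ≫ μ.f 0 = (mulTrans hx).app M ≫ (shiftResolution I e).ι.f 0 := by
    have h : (shiftResolution I e).ι.f 0 = (degreeShift n K e).map (augmentation I) :=
      injectiveResolutionOfExact_ι_f_zero ..
    rw [h]
    exact (mulTrans hx).naturality (augmentation I)
  have h := InjectiveResolution.isoRightDerivedObj_hom_naturality _ I (shiftResolution I e) μ hμ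
    (torsionFunctor n K) i
  refine eq_zero_of_app_eq_zero
    ((shiftResolution I e).isoRightDerivedObj (torsionFunctor n K) i).hom inferInstance ?_
  refine (app_apply_congr h a c).trans ?_
  refine (congrArg ((HomologicalComplex.homologyMap (T.map μ) i).app a) hz.symm).trans ?_
  refine homologyMap_app_eq_zero (T.map μ) i a z ?_
  exact Subtype.ext (mulApp_eq_zero hx _ a _ fun b s hs => hk b s (hke.trans hs))

/-- A graded module has no local cohomology in cohomological degree `i` if multiplication by all
powers of some form of positive degree is injective on it. -/
lemma isZero_localCohomologyModule_of_mono (i : ℕ) (M : GradedMod n K) {x : 𝓡} {e : ℕ}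
    (hx : x.IsHomogeneous e) (he : 0 < e)
    (h : ∀ k, Mono (((torsionFunctor n K).rightDerived i).map ((mulTrans (hx.pow k)).app M))) :
    IsZero (localCohomologyModule i M) := by
  refine isZero_of_forall_isZero_obj fun a c => ?_
  obtain ⟨k, hk⟩ := exists_rightDerived_mulTrans_eq_zero i M a c
  -- `x ^ k` has degree `e * k ≥ k`, so it kills `c`.
  exact eq_zero_of_app_eq_zero _ (h k) (hk _ _ _ (Nat.le_mul_of_pos_left k he))

end Multiplication

end BasicDoubleLink
end

noncomputable section

namespace BasicDoubleLink

/-! ### Local cohomology of quotient rings -/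

section Quotient

open Limits MvPolynomial

variable {n : ℕ} {K : Type u} [Field K]

local notation "𝓡" => MvPolynomial (Fin (n + 1)) K

lemma forall_mem_support_degree_eq_iff {p : 𝓡} {j : ℕ} :
    (∀ s ∈ p.support, (s.degree : ℤ) = j) ↔ p.IsHomogeneous j := by
  refine forall_congr' fun s => ?_
  rw [mem_support_iff, Nat.cast_inj, Finsupp.degree_eq_weight_one]
  rfl

/-- The degree `a + d` component of a decomposition `p = j + f g` is again such a decomposition,
with `g` replaced by a form of degree `a`. If `a < 0`, the product contributes nothing and `g = 0`
serves. -/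
lemma exists_form_sub_mul_mem {J I : Ideal 𝓡} (hJ : IsHomogeneousIdeal J)
    (hI : IsHomogeneousIdeal I) {f : 𝓡} {d : ℕ} (hf : f.IsHomogeneous d) {p : 𝓡} {a : ℤ}
    (hp : ∀ s ∈ p.support, (s.degree : ℤ) = a + d) (hpJ : p ∈ J + Ideal.span {f} * I) :
    ∃ g ∈ I, (∀ s ∈ g.support, (s.degree : ℤ) = a) ∧ p - f * g ∈ J := by
  by_cases hp0 : p = 0
  · exact ⟨0, I.zero_mem, by simp, by simp [hp0]⟩
  obtain ⟨s, hs⟩ := support_nonempty.2 hp0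
  have hs' := hp s hs
  rw [← hs'] at hp
  have hp' := forall_mem_support_degree_eq_iff.1 hp
  obtain ⟨j, hj, q, hq, hpq⟩ := Submodule.mem_sup.1 hpJ
  obtain ⟨g, hg, rfl⟩ := Ideal.mem_span_singleton_mul.1 hq
  have hjJ := isHomogeneousIdeal_iff.1 hJ j hj s.degree
  have hc := congrArg (homogeneousComponent s.degree) hpq
  rw [map_add, homogeneousComponent_eq_self hp'] at hc
  rcases lt_or_ge s.degree d with hlt | hle
  · rw [homogeneousComponent_mul_of_lt hf g hlt, add_zero] at hc
    exact ⟨0, I.zero_mem, by simp, by simpa [← hc] using hjJ⟩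
  · obtain ⟨k, hk⟩ := Nat.exists_eq_add_of_le hle
    have hak : a = k := by omega
    rw [hk, homogeneousComponent_mul_of_isHomogeneous hf, ← hk] at hc
    refine ⟨homogeneousComponent k g, isHomogeneousIdeal_iff.1 hI g hg k, ?_, ?_⟩
    · rw [hak]
      exact forall_mem_support_degree_eq_iff.2 (homogeneousComponent_isHomogeneous k g)
    · rw [← hc, add_sub_cancel_right]
      exact hjJ

lemma quotientPart_factor {J I : Ideal 𝓡} (h : J ≤ I) (a : ℤ) (y : 𝓡 ⧸ J)
    (hy : y ∈ quotientPart J a) :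
    (Ideal.Quotient.factorₐ K h).toLinearMap y ∈ quotientPart I a := by
  obtain ⟨p, hp, rfl⟩ := hy
  exact ⟨p, hp, rfl⟩

/-- The canonical map `R/J → R/I` for `J ≤ I`. -/
def quotientMap {J I : Ideal 𝓡} (h : J ≤ I) : quotientModule J ⟶ quotientModule I where
  app a := ModuleCat.ofHom
    ((Ideal.Quotient.factorₐ K h).toLinearMap.restrict (quotientPart_factor h a.deg))
  naturality a b t := by
    ext m
    exact Subtype.ext (map_mul (Ideal.Quotient.factorₐ K h)
      (Ideal.Quotient.mk J (monomial t.1 1)) m.1)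

/-- The class in `[R/J]_a` of a form of degree `a`. -/
def quotientClass (J : Ideal 𝓡) (a : Degrees n) (p : 𝓡)
    (hp : ∀ s ∈ p.support, (s.degree : ℤ) = a.deg) : (quotientModule J).obj a :=
  (⟨Ideal.Quotient.mk J p, p, hp, rfl⟩ : quotientPart J a.deg)

lemma exists_quotientClass_eq {J : Ideal 𝓡} {a : Degrees n} (m : (quotientModule J).obj a) :
    ∃ p hp, quotientClass J a p hp = m := by
  obtain ⟨p, hp, h⟩ := m.2
  exact ⟨p, hp, Subtype.ext h⟩

lemma quotientClass_eq_iff {J : Ideal 𝓡} {a : Degrees n} {p q : 𝓡} {hp hq} :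
    quotientClass J a p hp = quotientClass J a q hq ↔ p - q ∈ J :=
  Subtype.ext_iff.trans Ideal.Quotient.eq

lemma quotientClass_eq_zero_iff {J : Ideal 𝓡} {a : Degrees n} {p : 𝓡} {hp} :
    quotientClass J a p hp = 0 ↔ p ∈ J :=
  Subtype.ext_iff.trans Ideal.Quotient.eq_zero_iff_mem

lemma quotientMap_app_quotientClass {J I : Ideal 𝓡} (h : J ≤ I) {a : Degrees n} {p : 𝓡} (hp) :
    (quotientMap h).app a (quotientClass J a p hp) = quotientClass I a p hp :=
  rfl

lemma mul_support_degree {f : 𝓡} {d : ℕ} (hf : f.IsHomogeneous d) {p : 𝓡} {a : Degrees n}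
    (hp : ∀ s ∈ p.support, (s.degree : ℤ) = a.deg) :
    ∀ s ∈ (f * p).support, (s.degree : ℤ) = ((addDegree n d).obj a).deg := by
  classical
  intro s hs
  obtain ⟨s₁, h₁, s₂, h₂, rfl⟩ := Finset.mem_add.1 (support_mul _ _ hs)
  have h₃ := forall_mem_support_degree_eq_iff.2 hf s₁ h₁
  have h₄ := hp s₂ h₂
  change _ = a.deg + d
  rw [map_add]
  push_cast
  omega

lemma mulApp_quotientClass {f : 𝓡} {d : ℕ} (hf : f.IsHomogeneous d) (J : Ideal 𝓡) (a : Degrees n)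
    {p : 𝓡} (hp : ∀ s ∈ p.support, (s.degree : ℤ) = a.deg) :
    mulApp hf (quotientModule J) a (quotientClass J a p hp) =
      quotientClass J ((addDegree n d).obj a) (f * p) (mul_support_degree hf hp) :=
  Subtype.ext ((mulApp_quotientModule hf J a _).trans (map_mul _ f p).symm)

/-- The short exact sequence `0 → A → (R/J)(d) → (R/I')(d) → 0`, where `I' = J + f I`, `A` is the
kernel of `R/J → R/I`, and the first map is multiplication by `f`. -/
lemma exists_shortExact_mul {J I I' : Ideal 𝓡} (hJ : IsHomogeneousIdeal J)
    (hI : IsHomogeneousIdeal I) {f : 𝓡} {d : ℕ} (hf : f.IsHomogeneous d) (hr : IsRegularMod J f)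
    (hI' : I' = J + Ideal.span {f} * I) (hJI : J ≤ I) (hJI' : J ≤ I') {A : GradedMod n K}
    {ι : A ⟶ quotientModule J} {w : ι ≫ quotientMap hJI = 0}
    (h : (ShortComplex.mk ι (quotientMap hJI) w).ShortExact)
    {φ : A ⟶ (degreeShift n K d).obj (quotientModule J)}
    (hφ : ι ≫ (mulTrans hf).app (quotientModule J) = φ) :
    ∃ w', (ShortComplex.mk φ ((degreeShift n K d).map (quotientMap hJI')) w').ShortExact := by
  subst hφ
  have := h.mono_f
  -- Elements of `A` are classes of forms in `I`, and the first map multiplies such a form by `f`.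
  have key : ∀ (a : Degrees n) (z : A.obj a), ∃ p hp, p ∈ I ∧ ι.app a z = quotientClass J a p hp ∧
      (ι ≫ (mulTrans hf).app (quotientModule J)).app a z =
        quotientClass J ((addDegree n d).obj a) (f * p) (mul_support_degree hf hp) := by
    intro a z
    obtain ⟨p, hp, hpz⟩ := exists_quotientClass_eq (ι.app a z)
    refine ⟨p, hp, ?_, hpz.symm, ?_⟩
    · rw [← quotientClass_eq_zero_iff (hp := hp), ← quotientMap_app_quotientClass hJI hp, hpz]
      exact app_apply_congr w a z
    · rw [← mulApp_quotientClass hf J a hp, hpz]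
      rfl
  refine ⟨?_, shortExact_of_forall_app ?_ ?_ ?_⟩
  · ext a z
    obtain ⟨p, hp, hpI, -, hz⟩ := key a z
    refine (congrArg ((quotientMap hJI').app ((addDegree n d).obj a)) hz).trans ?_
    rw [quotientMap_app_quotientClass]
    refine quotientClass_eq_zero_iff.2 ?_
    rw [hI']
    exact Submodule.mem_sup_right (Ideal.mul_mem_mul (Ideal.mem_span_singleton_self f) hpI)
  · intro a z hz
    obtain ⟨p, hp, hpI, hz₁, hz₂⟩ := key a z
    refine eq_zero_of_app_eq_zero ι inferInstance (hz₁.trans ?_)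
    exact quotientClass_eq_zero_iff.2 (hr _ (quotientClass_eq_zero_iff.1 (hz₂.symm.trans hz)))
  · intro a y hy
    obtain ⟨p, hp, rfl⟩ := exists_quotientClass_eq (J := J) (a := (addDegree n d).obj a) y
    have hpI' : p ∈ I' := quotientClass_eq_zero_iff.1
      ((quotientMap_app_quotientClass hJI' hp).symm.trans hy)
    rw [hI'] at hpI'
    obtain ⟨g, hgI, hg, hpg⟩ := exists_form_sub_mul_mem hJ hI hf hp hpI'
    obtain ⟨z, hz⟩ := exists_app_eq h.exact a (quotientClass J a g hg)
      ((quotientMap_app_quotientClass hJI hg).trans (quotientClass_eq_zero_iff.2 hgI))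
    refine ⟨z, ?_⟩
    change mulApp hf (quotientModule J) a (ι.app a z) = _
    refine (congrArg (mulApp hf (quotientModule J) a) hz).trans ?_
    rw [mulApp_quotientClass]
    refine quotientClass_eq_iff.2 ?_
    rw [← neg_sub]
    exact J.neg_mem hpg
  · intro a x
    obtain ⟨p, hp, rfl⟩ := exists_quotientClass_eq (J := I') (a := (addDegree n d).obj a) x
    exact ⟨quotientClass J _ p hp, rfl⟩

lemma shortExact_kernel {J I : Ideal 𝓡} (hJI : J ≤ I) :
    (ShortComplex.mk (kernel.ι (quotientMap hJI)) (quotientMap hJI)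
      (kernel.condition _)).ShortExact where
  exact := ShortComplex.exact_kernel _
  mono_f := inferInstance
  epi_g := (NatTrans.epi_iff_epi_app _).2 fun a => (ModuleCat.epi_iff_surjective _).2 fun x => by
    obtain ⟨p, hp, rfl⟩ := exists_quotientClass_eq x
    exact ⟨quotientClass J _ p hp, rfl⟩

lemma isHomogeneousIdeal_top : IsHomogeneousIdeal (⊤ : Ideal 𝓡) :=
  isHomogeneousIdeal_iff.2 fun _ _ _ => Submodule.mem_top

/-- The case `I = ⊤` of `exists_shortExact_mul`, where the kernel `A` is all of `R/J`. -/
lemma exists_shortExact_mulTrans {J : Ideal 𝓡} (hJ : IsHomogeneousIdeal J) {f : 𝓡} {d : ℕ}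
    (hf : f.IsHomogeneous d) (hr : IsRegularMod J f) :
    ∃ (φ : (degreeShift n K d).obj (quotientModule J) ⟶
        (degreeShift n K d).obj (quotientModule (J ⊔ Ideal.span {f}))) (w : _ = _),
      (ShortComplex.mk ((mulTrans hf).app (quotientModule J)) φ w).ShortExact := by
  have hzero : ∀ a, ∀ m : (quotientModule (⊤ : Ideal 𝓡)).obj a, m = 0 := fun a m => by
    obtain ⟨p, hp, rfl⟩ := exists_quotientClass_eq m
    exact quotientClass_eq_zero_iff.2 Submodule.mem_top
  have h₀ : (ShortComplex.mk (𝟙 (quotientModule J)) (quotientMap (le_top : J ≤ ⊤))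
      ((isZero_of_forall_isZero_obj hzero).eq_of_tgt _ _)).ShortExact :=
    shortExact_of_forall_app (fun _ _ h => h) (fun _ y _ => ⟨y, rfl⟩)
      fun a x => ⟨0, (hzero a _).trans (hzero a x).symm⟩
  obtain ⟨w, h⟩ := exists_shortExact_mul hJ isHomogeneousIdeal_top hf hr
    (I' := J ⊔ Ideal.span {f}) (by rw [Ideal.mul_top]; rfl) le_top le_sup_left h₀
    (Category.id_comp _)
  exact ⟨_, _, h⟩

lemma isZero_localCohomologyModule_shift {i : ℕ} {M : GradedMod n K}
    (h : IsZero (localCohomologyModule i M)) (e : ℤ) :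
    IsZero (localCohomologyModule i (shift M e)) :=
  IsZero.of_iso ((degreeShift n K e).map_isZero h) (localCohomologyShiftIso i M e)

/-- Local cohomology vanishes below the grade of `𝔪`. -/
lemma ExtVanishing.isZero_localCohomologyModule {s : ℕ} : ∀ {J : Ideal 𝓡}, IsHomogeneousIdeal J →
    ExtVanishing (irrelevant n K) (𝓡 ⧸ J) s → ∀ i < s,
      IsZero (localCohomologyModule i (quotientModule J)) := by
  induction s with
  | zero => exact fun _ _ i hi => absurd hi i.not_lt_zero
  | succ s ih =>
    intro J hJ h i hi
    obtain ⟨e, he, x, hx, hr⟩ := h.exists_isRegularMod hJ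
    refine isZero_localCohomologyModule_of_mono i _ hx he fun k => ?_
    -- The kernel of `xᵏ` on `Hⁱ(R/J)` is the image of `Hⁱ⁻¹` of a shift of `R/(J + (xᵏ))`, zero by
    -- induction; for `i = 0` left exactness suffices.
    obtain ⟨φ, w, hS⟩ := exists_shortExact_mulTrans hJ (hx.pow k) (hr.pow k)
    cases i with
    | zero => exact mono_rightDerived_zero_map _ hS
    | succ i =>
      refine mono_rightDerived_succ_map _ hS i (isZero_localCohomologyModule_shift ?_ _)
      exact ih (hJ.sup (isHomogeneousIdeal_span_singleton (hx.pow k)))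
        (ExtVanishing.sup_span (hr.pow k) h) i (by omega)

/-- The comparison of the local cohomology of `R/I` and of `R/(J + f I)`. -/
lemma nonempty_localCohomologyModule_iso {J I I' : Ideal 𝓡} (hJ : IsHomogeneousIdeal J)
    (hI : IsHomogeneousIdeal I) {f : 𝓡} {d : ℕ} (hf : f.IsHomogeneous d) (hr : IsRegularMod J f)
    (hI' : I' = J + Ideal.span {f} * I) (hJI : J ≤ I) {s : ℕ}
    (hs : ExtVanishing (irrelevant n K) (𝓡 ⧸ J) s) {i : ℕ} (hi : i + 1 < s) :
    Nonempty (localCohomologyModule i (quotientModule I') ≅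
      shift (localCohomologyModule i (quotientModule I)) (-(d : ℤ))) := by
  have hz := hs.isZero_localCohomologyModule hJ
  have hA := shortExact_kernel hJI
  obtain ⟨w, hB⟩ := exists_shortExact_mul hJ hI hf hr hI' hJI (hI'.ge.trans' le_sup_left) hA rfl
  -- Both connecting isomorphisms `α` and `β` end in `Hⁱ⁺¹` of the common kernel.
  obtain ⟨α⟩ := nonempty_rightDerived_iso_succ (torsionFunctor n K) hA i
    (hz i (by omega)) (hz (i + 1) hi)
  obtain ⟨β⟩ := nonempty_rightDerived_iso_succ (torsionFunctor n K) hB i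
    (isZero_localCohomologyModule_shift (hz i (by omega)) d)
    (isZero_localCohomologyModule_shift (hz (i + 1) hi) d)
  let β' : localCohomologyModule i (shift (quotientModule I') d) ≅
    ((torsionFunctor n K).rightDerived (i + 1)).obj (kernel (quotientMap hJI)) := β
  exact ⟨(shiftShiftNegIso _ d).symm ≪≫ (degreeShift n K (-d)).mapIso
    ((localCohomologyShiftIso i (quotientModule I') d).symm ≪≫ β' ≪≫ α.symm)⟩

end Quotient

end BasicDoubleLink
end

noncomputable section

namespace BasicDoubleLink

/-! ### Basic double links -/

section Link

variable {A : Type u} [CommRing A] {J I : Ideal A} {f : A}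

lemma add_span_singleton_mul_le (hJI : J ≤ I) : J + Ideal.span {f} * I ≤ I :=
  sup_le hJI Ideal.mul_le_right

lemma isRegularMod_of_colon_eq (h : J.colon {f} = J) : IsRegularMod J f := fun p hp => by
  rw [← h]
  exact Submodule.mem_colon_singleton.2 (by rwa [smul_eq_mul, mul_comm])

/-- From `f p = j + f g` one gets `f (p - g) ∈ J`, hence `p - g ∈ J ⊆ I`. So multiplication by `f`
embeds `A/I` in `A/(J + fI)`. -/
lemma mul_mem_add_span_singleton_mul_iff (hf : IsRegularMod J f) (hJI : J ≤ I) {p : A} :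
    f * p ∈ J + Ideal.span {f} * I ↔ p ∈ I := by
  refine ⟨fun h => ?_, fun h => Submodule.mem_sup_right
    (Ideal.mul_mem_mul (Ideal.mem_span_singleton_self f) h)⟩
  obtain ⟨j, hj, q, hq, hpq⟩ := Submodule.mem_sup.1 h
  obtain ⟨g, hg, rfl⟩ := Ideal.mem_span_singleton_mul.1 hq
  have : p - g ∈ J := hf _ (by rwa [mul_sub, ← hpq, add_sub_cancel_right])
  simpa using I.add_mem (hJI this) hg

/-- This is read off the exact sequence `0 → A/I → A/(J + fI) → A/(J + (f)) → 0` whose first map is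
multiplication by `f`. -/
lemma associatedPrimes_add_span_singleton_mul_subset (hf : IsRegularMod J f) (hJI : J ≤ I) :
    associatedPrimes A (A ⧸ (J + Ideal.span {f} * I)) ⊆
      associatedPrimes A (A ⧸ I) ∪ associatedPrimes A (A ⧸ (J ⊔ Ideal.span {f})) := by
  have hle : J + Ideal.span {f} * I ≤ J ⊔ Ideal.span {f} := sup_le_sup_left Ideal.mul_le_left J
  refine associatedPrimes.subset_union_of_exact
    (f := Submodule.mapQ I (J + Ideal.span {f} * I) (LinearMap.lsmul A A f)
      fun p hp => (mul_mem_add_span_singleton_mul_iff hf hJI).2 hp)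
    (g := Submodule.factor hle) ?_ ?_
  · refine (injective_iff_map_eq_zero _).2 fun y hy => ?_
    obtain ⟨y, rfl⟩ := Ideal.Quotient.mk_surjective y
    exact Ideal.Quotient.eq_zero_iff_mem.2 ((mul_mem_add_span_singleton_mul_iff hf hJI).1
      (Ideal.Quotient.eq_zero_iff_mem.1 hy))
  · intro y
    obtain ⟨y, rfl⟩ := Ideal.Quotient.mk_surjective y
    constructor
    · intro hy
      obtain ⟨j, hj, q, hq, rfl⟩ := Submodule.mem_sup.1 (Ideal.Quotient.eq_zero_iff_mem.1 hy)
      obtain ⟨b, rfl⟩ := Ideal.mem_span_singleton'.1 hq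
      refine ⟨Ideal.Quotient.mk I b, Ideal.Quotient.eq.2 ?_⟩
      change f * b - (j + b * f) ∈ _
      rw [mul_comm f b, sub_add_cancel_right]
      exact neg_mem (Submodule.mem_sup_left hj)
    · rintro ⟨b, hb⟩
      obtain ⟨b, rfl⟩ := Ideal.Quotient.mk_surjective b
      rw [← hb]
      exact Ideal.Quotient.eq_zero_iff_mem.2
        (Submodule.mem_sup_right (Ideal.mul_mem_right b _ (Ideal.mem_span_singleton_self f)))

variable [IsNoetherianRing A]

/-- A prime over `J + fI` contains `I`, or contains `J` and `f`; in the second case regularity of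
`f` makes its height at least `J.height + 1`. -/
lemma height_add_span_singleton_mul (hf : IsRegularMod J f) (hJI : J ≤ I)
    (hc : I.height = J.height + 1) : (J + Ideal.span {f} * I).height = I.height := by
  refine le_antisymm (Ideal.height_mono (add_span_singleton_mul_le hJI)) ?_
  rw [(J + Ideal.span {f} * I).height_eq_inf_minimalPrimes]
  refine le_iInf₂ fun P hP => ?_
  have hPp := hP.isPrime
  have hJP : J ≤ P := le_sup_left.trans hP.1.2
  rcases hPp.mul_le.1 (le_sup_right.trans hP.1.2) with h | h
  · rw [hc]
    exact hf.height_add_one_le hPp hJP (h (Ideal.mem_span_singleton_self f))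
  · exact Ideal.height_mono h

/-- If `P = I : p`, then also `P = (J + fI) : fp`. -/
lemma associatedPrimes_subset_add_span_singleton_mul (hf : IsRegularMod J f) (hJI : J ≤ I) :
    associatedPrimes A (A ⧸ I) ⊆ associatedPrimes A (A ⧸ (J + Ideal.span {f} * I)) := by
  intro P hP
  obtain ⟨hPp, p, hp⟩ := mem_associatedPrimes_quotient_iff.1 hP
  refine mem_associatedPrimes_quotient_iff.2 ⟨hPp, f * p, fun a => ?_⟩
  rw [hp, mul_left_comm, mul_mem_add_span_singleton_mul_iff hf hJI]

lemma le_of_mem_associatedPrimes_quotient {P : Ideal A} (hP : P ∈ associatedPrimes A (A ⧸ I)) :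
    I ≤ P := by
  obtain ⟨-, p, hp⟩ := mem_associatedPrimes_quotient_iff.1 hP
  exact fun a ha => (hp a).2 (I.mul_mem_right p ha)

end Link

attribute [local instance] MvPolynomial.gradedAlgebra in
lemma IsHomogeneousIdeal.mul {n : ℕ} {K : Type u} [Field K]
    {I J : Ideal (MvPolynomial (Fin (n + 1)) K)} (hI : IsHomogeneousIdeal I)
    (hJ : IsHomogeneousIdeal J) : IsHomogeneousIdeal (I * J) :=
  Ideal.IsHomogeneous.mul hI hJ

end BasicDoubleLink

/-! ### The basic double link theorem -/

theorem mainTheorem12 {n : ℕ} {K : Type u} [Field K]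
    (J I : Ideal (MvPolynomial (Fin (n + 1)) K))
    (hJ : BasicDoubleLink.IsHomogeneousIdeal J) (hI : BasicDoubleLink.IsHomogeneousIdeal I)
    (hJ0 : J ≠ ⊥) (hJI : J ≤ I) (hcodim : I.height = J.height + 1)
    (hCM : BasicDoubleLink.IsCohenMacaulayQuotient J)
    (d : ℕ) (f : MvPolynomial (Fin (n + 1)) K) (hf : f.IsHomogeneous d)
    (hfJ : J.colon {f} = J) :
    (J + Ideal.span {f} * I).height = I.height ∧
    (∀ i : ℕ, ((i : ℕ∞) : WithBot ℕ∞) < ringKrullDim (MvPolynomial (Fin (n + 1)) K ⧸ I) →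
      Nonempty (BasicDoubleLink.localCohomologyModule i
          (BasicDoubleLink.quotientModule (J + Ideal.span {f} * I)) ≅
        BasicDoubleLink.shift (BasicDoubleLink.localCohomologyModule i
          (BasicDoubleLink.quotientModule I)) (-(d : ℤ)))) ∧
    (BasicDoubleLink.IsUnmixed I ↔
      BasicDoubleLink.IsUnmixed (J + Ideal.span {f} * I)) := by
  open BasicDoubleLink in
  have hr := isRegularMod_of_colon_eq hfJ
  have hheight := height_add_span_singleton_mul hr hJI hcodim
  refine ⟨hheight, ?_⟩
  -- The unit ideal has height `⊤`, so here `J = ⊤` as well; the zero ring has dimension `⊥` and no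
  -- `i` remains to be treated.
  by_cases hI' : I = ⊤
  · have hJ' : J = ⊤ := by
      by_contra hJ'
      rw [hI', Ideal.height_top] at hcodim
      have := J.height_ne_top hJ'
      exact absurd hcodim.symm (by simpa using this)
    subst hI' hJ'
    have htop : (⊤ : Ideal (MvPolynomial (Fin (n + 1)) K)) + Ideal.span {f} * ⊤ = ⊤ := top_sup_eq _
    rw [htop]
    refine ⟨fun i hi => ?_, Iff.rfl⟩
    rw [ringKrullDim_eq_bot_of_subsingleton] at hi
    exact absurd hi not_lt_bot
  have hle := add_span_singleton_mul_le (f := f) hJI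
  have hL := hJ.sup ((isHomogeneousIdeal_span_singleton hf).mul hI)
  obtain ⟨h₀, r, hr₀, hJh, hJd⟩ := exists_height_eq_and_ringKrullDim_eq hJ
    fun h => hI' (top_le_iff.1 (h ▸ hJI))
  obtain ⟨h₁, s, hs₁, hIh, hId⟩ := exists_height_eq_and_ringKrullDim_eq hI hI'
  obtain ⟨h₂, t, ht₂, hLh, hLd⟩ := exists_height_eq_and_ringKrullDim_eq hL
    fun h => hI' (top_le_iff.1 (h.symm.le.trans hle))
  have e₁ : h₁ = h₀ + 1 := by
    rw [hIh, hJh] at hcodim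
    exact_mod_cast hcodim
  have e₂ : h₂ = h₁ := by
    have := hLh.symm.trans (hheight.trans hIh)
    exact_mod_cast this
  obtain rfl : t = s := by omega
  -- By the dimension formula, `dim R/Ĩ = dim R/I = t` and `dim R/J = t + 1`; the extra unit gives
  -- `i + 1 < dim R/J` whenever `i < t`.
  obtain rfl : r = t + 1 := by omega
  have hext := extVanishing_of_isCohenMacaulayQuotient hCM hJd
  have hdim : ringKrullDim (MvPolynomial (Fin (n + 1)) K ⧸ (J + Ideal.span {f} * I)) =
    ringKrullDim (MvPolynomial (Fin (n + 1)) K ⧸ I) := hLd.trans hId.symm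
  refine ⟨fun i hi => ?_, fun h P hP => ?_, fun h P hP => ?_⟩
  · rw [hId] at hi
    have hi' : i < t := by exact_mod_cast hi
    exact nonempty_localCohomologyModule_iso hJ hI hf hr rfl hJI hext (Nat.succ_lt_succ hi')
  · rw [hdim]
    rcases associatedPrimes_add_span_singleton_mul_subset hr hJI hP with hP' | hP'
    · exact h P hP'
    · rw [hId]
      -- For `P` associated to `R/(J + (f))`, the vanishing of `Ext` below `t` gives `dim R/P ≥ t`;
      -- the opposite bound holds since `P` contains `J + fI`.
      refine le_antisymm ?_ ((hext.sup_span hr).le_ringKrullDim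
        (hJ.sup (isHomogeneousIdeal_span_singleton hf)) hP')
      rw [← hLd]
      exact ringKrullDim_quotient_anti (le_of_mem_associatedPrimes_quotient hP)
  · rw [← hdim]
    exact h P (associatedPrimes_subset_add_span_singleton_mul hr hJI hP)
end
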